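/- A Cantor space is a nonempty compact metrizable perfect zero-dimensional space. A minimal Cantor system $(X,T)$ is a homeomorphism $T$ of a Cantor space $X$ all of whose orbits $\{T^n x : n\in\mathbb Z\}$ are dense. Let $M(X,T)$ be the set of $T$-invariant Borel probability measures on $X$, and let $G(X,T)=C(X,\mathbb Z)/\{f-f\circ T : f\in C(X,\mathbb Z)\}$. Let $\operatorname{Inf}(G(X,T))$ be the subgroup of classes of those $f\in C(X,\mathbb Z)$ with $\int f\,d\mu=0$ for all $\mu\in M(X,T)$. The quotient $G(X,T)/\operatorname{Inf}(G(X,T))$ is given the positive cone consisting of the classes of nonnegative functions, and the distinguished order unit given by the class of the constant function $1$. In a group $G$ with positive cone $G_+$ write $a<b$ if $b-a\in G_+\setminus\{0\}$. A unital epimorphism $\varphi:(G,G_+,u)\to(H,H_+,v)$ is a surjective group homomorphism with $\varphi(G_+)\subseteq H_+$ and $\varphi(u)=v$. It is exhaustive if for every $g\in G_+$ and every $h\in H$ with $0<h<\varphi(g)$ there is $g'\in G$ with $\varphi(g')=h$ and $0<g'<g$. We say that $(Y,S)$ is a speedup of $(X,T)$ if there is a function $p:X\to\{1,2,3,\dots\}$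 (not assumed continuous) such that $(Y,S)$ is topologically conjugate to $(X,T')$, where $T'(x)=T^{p(x)}(x)$. **Theorem.** Let $(Y,S)$ and $(X,T)$ be minimal Cantor systems. The following are equivalent: 1. $(Y,S)$ is a speedup of $(X,T)$. 2. There exists an exhaustive unital epimorphism $\varphi: G(Y,S)/\operatorname{Inf}(G(Y,S))\to G(X,T)/\operatorname{Inf}(G(X,T))$. 3. There exists a homeomorphism $F:X\to Y$ whose pushforward $F_*\mu=\mu\circ F^{-1}$ maps $M(X,T)$ injectively into $M(Y,S)$. -/

import Mathlib

open MeasureTheory Topology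

/-- A Cantor space: a nonempty compact metrizable perfect zero-dimensional space. -/
class IsCantorSpace (X : Type*) [TopologicalSpace X] : Prop
    extends CompactSpace X, TopologicalSpace.MetrizableSpace X, PerfectSpace X where
  nonempty : Nonempty X
  /-- Zero-dimensionality: the clopen sets form a basis of the topology. -/
  isTopologicalBasis_isClopen : TopologicalSpace.IsTopologicalBasis {s : Set X | IsClopen s}

/-- The homeomorphism `T` is minimal: every two-sided orbit is dense. -/
def IsMinimalHomeo {X : Type*} [TopologicalSpace X] (T : X ≃ₜ X) : Prop :=
  ∀ x : X, Dense (Set.range fun n : ℤ => (T ^ n) x)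

/-- `(Y, S)` is a speedup of `(X, T)`: for some jump function `p` with positive values, without any
continuity requirement, `(Y, S)` is topologically conjugate to `(X, T')`,
where `T' x = T ^ (p x) x`. -/
def IsSpeedup {X Y : Type*} [TopologicalSpace X] [TopologicalSpace Y]
    (S : Y ≃ₜ Y) (T : X ≃ₜ X) : Prop :=
  ∃ p : X → ℕ, (∀ x, 0 < p x) ∧ ∃ h : X ≃ₜ Y, ∀ x, h (T^[p x] x) = S (h x)

/-- The set `M(X, T)` of all `T`-invariant (Borel) probability measures on `X`. -/
def invariantMeasures {X : Type*} [TopologicalSpace X] [MeasurableSpace X]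
    (T : X ≃ₜ X) : Set (Measure X) :=
  {μ | IsProbabilityMeasure μ ∧ ∀ A : Set X, MeasurableSet A → μ (T ⁻¹' A) = μ A}

/-- The subgroup of `T`-coboundaries `f - f ∘ T` in `C(X, ℤ)`. -/
def coboundaries {X : Type*} [TopologicalSpace X] (T : X ≃ₜ X) : AddSubgroup C(X, ℤ) where
  carrier := {g | ∃ f : C(X, ℤ), g = f - f.comp (T : C(X, X))}
  zero_mem' := ⟨0, by ext; simp⟩
  add_mem' := by
    rintro _ _ ⟨f, rfl⟩ ⟨g, rfl⟩
    exact ⟨f + g, by ext; simp; ring⟩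
  neg_mem' := by
    rintro _ ⟨f, rfl⟩
    exact ⟨-f, by ext; simp; ring⟩

/-- The group `G(X, T) = C(X, ℤ) / Cob(X, T)`. -/
abbrev DimGroup {X : Type*} [TopologicalSpace X] (T : X ≃ₜ X) : Type _ :=
  C(X, ℤ) ⧸ coboundaries T

theorem integrable_intCast {X : Type*} [TopologicalSpace X] [CompactSpace X] [MeasurableSpace X]
    [BorelSpace X] (μ : Measure X) [IsFiniteMeasure μ] (f : C(X, ℤ)) :
    Integrable (fun x => (f x : ℝ)) μ := by
  have hc : Continuous fun x => (f x : ℝ) := by fun_prop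
  exact hc.integrable_of_hasCompactSupport (HasCompactSupport.of_compactSpace _)

/-- The functions in `C(X, ℤ)` whose integral against every invariant probability measure
vanishes. -/
def infFunctions {X : Type*} [TopologicalSpace X] [CompactSpace X] [MeasurableSpace X]
    [BorelSpace X] (T : X ≃ₜ X) : AddSubgroup C(X, ℤ) where
  carrier := {f | ∀ μ ∈ invariantMeasures T, ∫ x, (f x : ℝ) ∂μ = 0}
  zero_mem' := by intro μ _; simp
  add_mem' := by
    intro f g hf hg μ hμ
    have := hμ.1
    simp only [ContinuousMap.add_apply, Int.cast_add]
    rw [integral_add (integrable_intCast μ f) (integrable_intCast μ g), hf μ hμ, hg μ hμ, add_zero]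
  neg_mem' := by
    intro f hf μ hμ
    simp only [ContinuousMap.neg_apply, Int.cast_neg]
    rw [integral_neg, hf μ hμ, neg_zero]

/-- The subgroup `Inf(G(X, T))` of `G(X, T)`: the classes of functions in `infFunctions T`. -/
def infSubgroup {X : Type*} [TopologicalSpace X] [CompactSpace X] [MeasurableSpace X]
    [BorelSpace X] (T : X ≃ₜ X) : AddSubgroup (DimGroup T) :=
  (infFunctions T).map (QuotientAddGroup.mk' (coboundaries T))

/-- The group `G(X, T) / Inf(G(X, T))`. -/
abbrev DimGroupModInf {X : Type*} [TopologicalSpace X] [CompactSpace X] [MeasurableSpace X]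
    [BorelSpace X] (T : X ≃ₜ X) : Type _ :=
  DimGroup T ⧸ infSubgroup T

/-- The class `[f]` in `G(X, T) / Inf(G(X, T))` of a function `f`. -/
def dimClass {X : Type*} [TopologicalSpace X] [CompactSpace X] [MeasurableSpace X]
    [BorelSpace X] (T : X ≃ₜ X) : C(X, ℤ) →+ DimGroupModInf T :=
  (QuotientAddGroup.mk' (infSubgroup T)).comp (QuotientAddGroup.mk' (coboundaries T))

/-- The positive cone of `G(X, T) / Inf(G(X, T))`: the classes of nonnegative functions. -/
def posCone {X : Type*} [TopologicalSpace X] [CompactSpace X] [MeasurableSpace X]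
    [BorelSpace X] (T : X ≃ₜ X) : Set (DimGroupModInf T) :=
  {a | ∃ f : C(X, ℤ), (∀ x, 0 ≤ f x) ∧ dimClass T f = a}

/-- The distinguished order unit: the class of the constant function one. -/
def orderUnit {X : Type*} [TopologicalSpace X] [CompactSpace X] [MeasurableSpace X]
    [BorelSpace X] (T : X ≃ₜ X) : DimGroupModInf T :=
  dimClass T 1

/-- The strict order `a < b` on a group given by a positive cone `P`: `b - a ∈ P \ {0}`. -/
def coneLT {G : Type*} [AddCommGroup G] (P : Set G) (a b : G) : Prop :=
  b - a ∈ P \ {0}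

/-- `φ` is an exhaustive unital epimorphism from `(G, P, u)` onto `(H, Q, v)`, where `P`, `Q` are
the positive cones and `u`, `v` the distinguished order units. -/
structure IsExhaustiveUnitalEpi {G H : Type*} [AddCommGroup G] [AddCommGroup H]
    (P : Set G) (u : G) (Q : Set H) (v : H) (φ : G →+ H) : Prop where
  surjective : Function.Surjective φ
  map_pos : ∀ g ∈ P, φ g ∈ Q
  map_unit : φ u = v
  exhaustive : ∀ g ∈ P, ∀ h : H, coneLT Q 0 h → coneLT Q h (φ g) →
    ∃ g' : G, φ g' = h ∧ coneLT P 0 g' ∧ coneLT P g' g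

set_option linter.unusedSectionVars false

/-! ### Powers of a homeomorphism -/

namespace Homeomorph

/-! Everything rests on comparison. Weak limits of empirical measures show that a function with
positive integral against every invariant measure has positive sums along all orbit segments of some
fixed length (`exists_forall_orbit_sum_pos`). Hence, if `a, b ≥ 0` and `∫ a < ∫ b` for all invariant
measures, greedy matching along orbits moves `a` below `b` by positive powers of `T` only
(`exists_positive_transport`). In particular the strict order on the group modulo infinitesimals is
the order by integrals, and inequalities between clopen sets are realised by inclusions.

1 → 3: a speedup agrees pointwise with powers of `T`, so it preserves every `T`-invariant measure,
and the conjugacy pushes these to `S`-invariant measures. 3 → 2: compose functions with `F`;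
comparison for `T` gives exhaustiveness. 2 → 3: relate a clopen `A` in `Y` to a clopen `B` in `X`
when `φ` sends the class of the indicator of `A` to that of `B`. Comparison for `T` refines such
pairs from `Y` to `X`; exhaustiveness and comparison for `S` refine them from `X` to `Y`. A
back-and-forth argument then yields `F`.

3 → 1 is the hard part. The conjugate `R` of `S` by `F` preserves every `T`-invariant measure.
Clopen sets of equal measures are matched by positive powers of `T` except at one point, whose image
can be prescribed (`IsMinimalHomeo.exists_pointed_matching`). Applied to the Kakutani–Rokhlin towers
of `R`, this makes a conjugate of `R` a positive power of `T` off a smaller roof, without changing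
it off the previous roof (`IsMinimalHomeo.exists_conj_positive_off`). The roofs shrink to a point
`t`, at which the map is kept equal to `T`. The identifications of `X` with `Y` converge because
each clopen set is eventually respected, and the limit conjugates `S` to a speedup of `T`. -/

theorem pow_apply_eq_iterate {X : Type*} [TopologicalSpace X] (T : X ≃ₜ X) (n : ℕ) (x : X) :
    (T ^ n) x = T^[n] x := by
  induction n generalizing x with
  | zero => rfl
  | succ n ih => rw [pow_succ, Homeomorph.mul_apply, ih, Function.iterate_succ_apply]

theorem pow_apply_pow_apply {X : Type*} [TopologicalSpace X] (T : X ≃ₜ X) (m n : ℕ) (x : X) :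
    (T ^ m) ((T ^ n) x) = (T ^ (m + n)) x := by
  rw [pow_add, Homeomorph.mul_apply]

end Homeomorph

/-! ### Clopen sets of a Cantor space -/

section CantorSpace

variable {X : Type*} [TopologicalSpace X] [IsCantorSpace X]

theorem IsCantorSpace.exists_isClopen_subset {x : X} {U : Set X} (hU : IsOpen U) (hx : x ∈ U) :
    ∃ V, IsClopen V ∧ x ∈ V ∧ V ⊆ U := by
  obtain ⟨V, hV, h⟩ := (IsCantorSpace.isTopologicalBasis_isClopen (X := X)).exists_subset_of_mem_open
    hx hU
  exact ⟨V, hV, h⟩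

theorem IsCantorSpace.exists_isClopen_mem_notMem {x y : X} (h : x ≠ y) :
    ∃ V : Set X, IsClopen V ∧ x ∈ V ∧ y ∉ V := by
  obtain ⟨V, hV, hx, hVU⟩ := IsCantorSpace.exists_isClopen_subset (x := x)
    (isOpen_compl_singleton (x := y)) h
  exact ⟨V, hV, hx, fun hy => hVU hy rfl⟩

instance IsCantorSpace.totallyDisconnectedSpace : TotallyDisconnectedSpace X := by
  have : TotallySeparatedSpace X := by
    refine totallySeparatedSpace_iff_exists_isClopen.2 fun x y h => ?_
    obtain ⟨V, hV, hx, hy⟩ := IsCantorSpace.exists_isClopen_mem_notMem h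
    exact ⟨V, hV, hx, hy⟩
  infer_instance

instance IsCantorSpace.countable_clopens : Countable (TopologicalSpace.Clopens X) :=
  TopologicalSpace.Clopens.countable_iff_secondCountable.2 inferInstance

variable (X) in
theorem IsCantorSpace.exists_isClopen_enumeration :
    ∃ V : ℕ → Set X, (∀ n, IsClopen (V n)) ∧ ∀ W, IsClopen W → ∃ n, V n = W := by
  obtain ⟨f, hf⟩ := exists_surjective_nat (TopologicalSpace.Clopens X)
  exact ⟨fun n => f n, fun n => (f n).isClopen, fun W hW => (hf ⟨W, hW⟩).imp fun n hn => by simp [hn]⟩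

/-- Every point has a decreasing neighbourhood basis of clopen sets. -/
theorem IsCantorSpace.exists_antitone_isClopen_basis (x : X) :
    ∃ U : ℕ → Set X, Antitone U ∧ (∀ n, IsClopen (U n)) ∧ (∀ n, x ∈ U n) ∧
      ∀ W, IsOpen W → x ∈ W → ∃ n, U n ⊆ W := by
  obtain ⟨V, hV, hsurj⟩ := IsCantorSpace.exists_isClopen_enumeration X
  classical
  refine ⟨fun n => ⋂ k ∈ Finset.range n, if x ∈ V k then V k else (V k)ᶜ, ?_, ?_, ?_, ?_⟩
  · intro m n hmn y hy
    simp only [Set.mem_iInter, Finset.mem_range] at hy ⊢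
    exact fun k hk => hy k (hk.trans_le hmn)
  · refine fun n => isClopen_biInter_finset fun k _ => ?_
    split_ifs
    exacts [hV k, (hV k).compl]
  · intro n
    simp only [Set.mem_iInter]
    intro k _
    split_ifs with h
    exacts [h, h]
  · intro W hW hx
    obtain ⟨C, hC, hxC, hCW⟩ := IsCantorSpace.exists_isClopen_subset hW hx
    obtain ⟨n, rfl⟩ := hsurj C hC
    refine ⟨n + 1, fun y hy => hCW ?_⟩
    simp only [Set.mem_iInter, Finset.mem_range] at hy
    simpa [hxC] using hy n (Nat.lt_succ_self n)

/-- Clopen sets form a generating π-system. -/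
theorem IsCantorSpace.borel_eq_generateFrom [MeasurableSpace X] [BorelSpace X] :
    ‹MeasurableSpace X› = MeasurableSpace.generateFrom {s : Set X | IsClopen s} := by
  rw [BorelSpace.measurable_eq (α := X)]
  exact (IsCantorSpace.isTopologicalBasis_isClopen (X := X)).borel_eq_generateFrom

end CantorSpace

/-! ### Aperiodicity and conjugates of minimal homeomorphisms -/

section Minimal

variable {X : Type*} [TopologicalSpace X] [IsCantorSpace X] {T : X ≃ₜ X}

/-- A periodic point has a finite orbit; if it is dense, the space is finite, hence discrete,
contradicting perfectness. -/
theorem IsMinimalHomeo.pow_apply_ne (hT : IsMinimalHomeo T) {n : ℕ} (hn : 0 < n) (x : X) :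
    (T ^ n) x ≠ x := by
  intro h
  have hfin : (Set.range fun k : ℤ => (T ^ k) x).Finite := by
    refine (Set.finite_range fun i : Fin n => (T ^ (i : ℕ)) x).subset ?_
    rintro _ ⟨k, rfl⟩
    have hn' : (n : ℤ) ≠ 0 := by omega
    refine ⟨⟨(k % n).toNat, by
      have := Int.emod_lt_of_pos k (b := n) (by omega)
      have := Int.emod_nonneg k hn'
      omega⟩, ?_⟩
    have h1 : ((T ^ n) ^ (k / n)) x = x := by
      have hz : ∀ m : ℕ, ((T ^ n) ^ m) x = x := fun m => by
        rw [Homeomorph.pow_apply_eq_iterate]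
        exact Function.iterate_fixed h m
      obtain ⟨m, hm | hm⟩ := Int.eq_nat_or_neg (k / n)
      · rw [hm, zpow_natCast, hz]
      · rw [hm, zpow_neg, zpow_natCast, Homeomorph.inv_apply, Homeomorph.symm_apply_eq, hz]
    have h2 : T ^ k = T ^ ((k % n).toNat) * (T ^ n) ^ (k / n) := by
      rw [← zpow_natCast, ← zpow_natCast T n, ← zpow_mul, ← zpow_add,
        Int.toNat_of_nonneg (Int.emod_nonneg k hn'), Int.emod_add_mul_ediv]
    simp only [h2, Homeomorph.mul_apply, h1]
  have huniv : (Set.range fun k : ℤ => (T ^ k) x) = Set.univ := by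
    rw [← hfin.isClosed.closure_eq, (hT x).closure_eq]
  have : Finite X := Set.finite_univ_iff.1 (huniv ▸ hfin)
  have hd : IsOpen ({x} : Set X) := isOpen_discrete _
  have := PerfectSpace.univ_preperfect (α := X)
  have hacc := this x (Set.mem_univ x)
  rw [accPt_iff_nhds] at hacc
  obtain ⟨y, hy, hyx⟩ := hacc {x} (hd.mem_nhds rfl)
  exact hyx hy.1

theorem IsMinimalHomeo.pow_apply_injective (hT : IsMinimalHomeo T) {m n : ℕ} {x : X}
    (h : (T ^ m) x = (T ^ n) x) : m = n := by
  wlog hmn : m ≤ n generalizing m n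
  · exact (this h.symm (by omega)).symm
  obtain ⟨k, rfl⟩ := Nat.exists_eq_add_of_le hmn
  rw [← Homeomorph.pow_apply_pow_apply] at h
  have h' := (T ^ m).injective h
  by_contra hk
  exact hT.pow_apply_ne (n := k) (by omega) x h'.symm

theorem IsMinimalHomeo.inv (hT : IsMinimalHomeo T) : IsMinimalHomeo T⁻¹ := by
  intro x
  convert hT x using 1
  ext y
  constructor
  · rintro ⟨n, rfl⟩
    exact ⟨-n, by simp⟩
  · rintro ⟨n, rfl⟩
    exact ⟨-n, by simp⟩

theorem IsMinimalHomeo.conj {Y : Type*} [TopologicalSpace Y] {S : Y ≃ₜ Y} (hS : IsMinimalHomeo S)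
    (h : X ≃ₜ Y) : IsMinimalHomeo ((h.trans S).trans h.symm) := by
  intro x
  have hpow : ∀ n : ℤ, ∀ x, (((h.trans S).trans h.symm) ^ n) x = h.symm ((S ^ n) (h x)) := by
    have hnat : ∀ n : ℕ, ∀ x, (((h.trans S).trans h.symm) ^ n) x = h.symm ((S ^ n) (h x)) := by
      intro n
      induction n with
      | zero => simp
      | succ n ih => intro x; simp [pow_succ, ih]
    intro n x
    obtain ⟨m, rfl | rfl⟩ := Int.eq_nat_or_neg n
    · simpa using hnat m x
    · rw [zpow_neg, zpow_natCast, Homeomorph.inv_apply, Homeomorph.symm_apply_eq, hnat]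
      simp
  have := (h.symm.surjective.denseRange).dense_image h.symm.continuous (hS (h x))
  convert this using 1
  rw [← Set.range_comp]
  congr 1
  ext n
  exact hpow n x

end Minimal

/-! ### Integrals of integer-valued functions -/

section Integral

variable {X : Type*} [TopologicalSpace X] [CompactSpace X] [MeasurableSpace X] [BorelSpace X]

/-- The integral of an integer-valued continuous function. -/
noncomputable def intMean (μ : Measure X) (f : C(X, ℤ)) : ℝ := ∫ x, (f x : ℝ) ∂μ

variable (μ : Measure X) [IsFiniteMeasure μ]

theorem intMean_add (f g : C(X, ℤ)) : intMean μ (f + g) = intMean μ f + intMean μ g := by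
  simp only [intMean, ContinuousMap.add_apply, Int.cast_add]
  exact integral_add (integrable_intCast μ f) (integrable_intCast μ g)

theorem intMean_zero : intMean μ 0 = 0 := by simp [intMean]

theorem intMean_neg (f : C(X, ℤ)) : intMean μ (-f) = -intMean μ f := by
  simp only [intMean, ContinuousMap.neg_apply, Int.cast_neg]
  exact integral_neg _

theorem intMean_sub (f g : C(X, ℤ)) : intMean μ (f - g) = intMean μ f - intMean μ g := by
  rw [sub_eq_add_neg, intMean_add, intMean_neg, sub_eq_add_neg]

theorem intMean_sum {ι : Type*} (s : Finset ι) (f : ι → C(X, ℤ)) :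
    intMean μ (∑ i ∈ s, f i) = ∑ i ∈ s, intMean μ (f i) := by
  classical
  induction s using Finset.induction_on with
  | empty => simp [intMean_zero]
  | insert a s ha ih => rw [Finset.sum_insert ha, Finset.sum_insert ha, intMean_add, ih]

theorem intMean_mono {f g : C(X, ℤ)} (h : ∀ x, f x ≤ g x) : intMean μ f ≤ intMean μ g :=
  integral_mono (integrable_intCast μ f) (integrable_intCast μ g) fun x => by
    simpa using h x

theorem intMean_one [IsProbabilityMeasure μ] : intMean μ 1 = 1 := by simp [intMean]

end Integral

/-! ### Maps preserving all invariant measures -/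

section Invariant

variable {X : Type*} [TopologicalSpace X] [MeasurableSpace X] [BorelSpace X]

theorem measurePreserving_of_mem {T : X ≃ₜ X} {μ : Measure X} (hμ : μ ∈ invariantMeasures T) :
    MeasurePreserving T μ μ :=
  ⟨T.continuous.measurable, Measure.ext fun A hA => by
    rw [Measure.map_apply T.continuous.measurable hA, hμ.2 A hA]⟩

theorem mem_invariantMeasures_iff {T : X ≃ₜ X} {μ : Measure X} :
    μ ∈ invariantMeasures T ↔ IsProbabilityMeasure μ ∧ MeasurePreserving T μ μ :=
  ⟨fun h => ⟨h.1, measurePreserving_of_mem h⟩,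
    fun h => ⟨h.1, fun _ hA => h.2.measure_preimage hA.nullMeasurableSet⟩⟩

/-- `g` preserves every `T`-invariant probability measure. -/
def PreservesInvariant (T : X ≃ₜ X) (g : X → X) : Prop :=
  ∀ μ ∈ invariantMeasures T, MeasurePreserving g μ μ

variable {T : X ≃ₜ X}

theorem PreservesInvariant.self : PreservesInvariant T T := fun _ => measurePreserving_of_mem

theorem MeasureTheory.MeasurePreserving.homeo_symm
    {g : X ≃ₜ X} {μ : Measure X} (h : MeasurePreserving g μ μ) : MeasurePreserving g.symm μ μ :=
  MeasurePreserving.symm g.toMeasurableEquiv h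

theorem PreservesInvariant.symm {g : X ≃ₜ X} (hg : PreservesInvariant T g) :
    PreservesInvariant T g.symm := fun μ hμ => (hg μ hμ).homeo_symm

theorem PreservesInvariant.comp {f g : X → X} (hf : PreservesInvariant T f)
    (hg : PreservesInvariant T g) : PreservesInvariant T (f ∘ g) :=
  fun μ hμ => (hf μ hμ).comp (hg μ hμ)

theorem PreservesInvariant.pow {g : X ≃ₜ X} (hg : PreservesInvariant T g) (n : ℕ) :
    PreservesInvariant T (g ^ n : X ≃ₜ X) := fun μ hμ => by
  have : ⇑(g ^ n) = g^[n] := funext fun x => g.pow_apply_eq_iterate n x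
  rw [this]
  exact (hg μ hμ).iterate n

theorem invariantMeasures_inv : invariantMeasures T⁻¹ = invariantMeasures T := by
  ext μ
  rw [mem_invariantMeasures_iff, mem_invariantMeasures_iff]
  refine and_congr_right fun _ => ⟨fun h => ?_, fun h => h.homeo_symm⟩
  have : MeasurePreserving (T⁻¹ : X ≃ₜ X).symm μ μ := h.homeo_symm
  exact this

theorem intMean_comp {g : X ≃ₜ X} {μ : Measure X} (h : MeasurePreserving g μ μ) (f : C(X, ℤ)) :
    intMean μ (f.comp (g : C(X, X))) = intMean μ f := by
  simp only [intMean, ContinuousMap.comp_apply, ContinuousMap.coe_coe]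
  exact h.integral_comp g.measurableEmbedding (fun x => (f x : ℝ))

end Invariant

/-! ### Empirical measures and uniform positivity of orbit sums -/

section UniformPositivity

open Filter

variable {X : Type*} [TopologicalSpace X] [IsCantorSpace X] [MeasurableSpace X] [BorelSpace X]

/-- The uniform probability measure on an orbit segment of length `n + 1`. -/
noncomputable def empiricalMeasure (T : X ≃ₜ X) (n : ℕ) (x : X) : Measure X :=
  ((n + 1 : ℕ) : ENNReal)⁻¹ • ∑ i ∈ Finset.range (n + 1), Measure.dirac ((T ^ i) x)

instance (T : X ≃ₜ X) (n : ℕ) (x : X) : IsProbabilityMeasure (empiricalMeasure T n x) := ⟨by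
  simp only [empiricalMeasure, Measure.smul_apply, Measure.finsetSum_apply, measure_univ,
    Finset.sum_const, Finset.card_range, smul_eq_mul, nsmul_eq_mul, mul_one]
  exact ENNReal.inv_mul_cancel (by simp) (by simp)⟩

theorem integral_empiricalMeasure (T : X ≃ₜ X) (n : ℕ) (x : X) {f : X → ℝ} (hf : Continuous f) :
    ∫ y, f y ∂(empiricalMeasure T n x) =
      ((n : ℝ) + 1)⁻¹ * ∑ i ∈ Finset.range (n + 1), f ((T ^ i) x) := by
  rw [empiricalMeasure, integral_smul_measure, integral_finsetSum_measure]
  · have : (((n + 1 : ℕ) : ENNReal)⁻¹).toReal = ((n : ℝ) + 1)⁻¹ := by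
      rw [ENNReal.toReal_inv, ENNReal.toReal_natCast]; push_cast; rfl
    rw [this]
    simp
  · intro i _
    exact hf.integrable_of_hasCompactSupport (HasCompactSupport.of_compactSpace _)

/-- A weak limit of empirical measures along orbit segments of growing length is invariant. -/
theorem exists_invariantMeasure_of_orbit_segments (T : X ≃ₜ X) (x : ℕ → X) :
    ∃ μ ∈ invariantMeasures T, ∃ U : Filter ℕ, U.NeBot ∧ ∀ f : C(X, ℝ),
      Tendsto (fun n : ℕ => ((n : ℝ) + 1)⁻¹ * ∑ i ∈ Finset.range (n + 1), f ((T ^ i) (x n))) U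
        (𝓝 (∫ y, f y ∂μ)) := by
  let ν : ℕ → ProbabilityMeasure X := fun n => ⟨empiricalMeasure T n (x n), inferInstance⟩
  -- A free ultrafilter gives a limit by compactness alone, with no choice of subsequence.
  let U : Ultrafilter ℕ := hyperfilter ℕ
  obtain ⟨μ, -, hμ⟩ := isCompact_univ.ultrafilter_le_nhds (U.map ν) (by simp)
  have hlim : ∀ f : C(X, ℝ),
      Tendsto (fun n : ℕ => ((n : ℝ) + 1)⁻¹ * ∑ i ∈ Finset.range (n + 1), f ((T ^ i) (x n)))
        (U : Filter ℕ) (𝓝 (∫ y, f y ∂(μ : Measure X))) := by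
    intro f
    have := ProbabilityMeasure.tendsto_iff_forall_integral_tendsto.1
      (show Tendsto ν (U : Filter ℕ) (𝓝 μ) from hμ) (BoundedContinuousFunction.mkOfCompact f)
    simp only [BoundedContinuousFunction.mkOfCompact_apply] at this
    refine this.congr fun n => ?_
    exact integral_empiricalMeasure T n (x n) f.continuous
  refine ⟨μ, mem_invariantMeasures_iff.2 ⟨μ.2, T.continuous.measurable, ?_⟩, U, inferInstance, hlim⟩
  have : IsProbabilityMeasure (Measure.map T (μ : Measure X)) :=
    Measure.isProbabilityMeasure_map T.continuous.aemeasurable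
  refine ext_of_forall_integral_eq_of_IsFiniteMeasure fun f => ?_
  rw [integral_map T.continuous.aemeasurable f.continuous.aestronglyMeasurable]
  have h1 := hlim (f.toContinuousMap.comp (T : C(X, X)))
  have h2 := hlim f.toContinuousMap
  -- The sums for `f ∘ T` and `f` telescope to a difference of two values, so the averages differ by
  -- at most `2‖f‖ / (n + 1)`.
  have h0 : Tendsto (fun n : ℕ => ((n : ℝ) + 1)⁻¹ * (2 * ‖f‖)) (U : Filter ℕ) (𝓝 0) := by
    have : Tendsto (fun n : ℕ => ((n : ℝ) + 1)⁻¹ * (2 * ‖f‖)) atTop (𝓝 (0 * (2 * ‖f‖))) :=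
      (tendsto_inv_atTop_zero.comp
        (tendsto_atTop_add_const_right _ 1 tendsto_natCast_atTop_atTop)).mul_const _
    rw [zero_mul] at this
    exact this.mono_left (by rw [← Nat.cofinite_eq_atTop]; exact hyperfilter_le_cofinite)
  have h3 := squeeze_zero_norm (fun n => ?_) h0 (f := fun n : ℕ =>
    ((n : ℝ) + 1)⁻¹ * ∑ i ∈ Finset.range (n + 1), (f.toContinuousMap.comp (T : C(X, X))) ((T ^ i) (x n)) -
    ((n : ℝ) + 1)⁻¹ * ∑ i ∈ Finset.range (n + 1), f.toContinuousMap ((T ^ i) (x n)))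
  · have := tendsto_nhds_unique (h1.sub h2) h3
    exact sub_eq_zero.1 this
  · rw [← mul_sub, norm_mul, norm_inv, ← Finset.sum_sub_distrib]
    have hn : ‖(n : ℝ) + 1‖ = n + 1 := by rw [Real.norm_of_nonneg]; positivity
    rw [hn]
    refine mul_le_mul_of_nonneg_left ?_ (by positivity)
    have : ∀ i, (f.toContinuousMap.comp (T : C(X, X))) ((T ^ i) (x n)) =
        f ((T ^ (i + 1)) (x n)) := fun i => by
      rw [pow_succ']; rfl
    simp only [this]
    have hs : ∑ i ∈ Finset.range (n + 1), (f ((T ^ (i + 1)) (x n)) - f ((T ^ i) (x n))) =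
        f ((T ^ (n + 1)) (x n)) - f (x n) :=
      Finset.sum_range_sub (fun i => f ((T ^ i) (x n))) (n + 1)
    calc _ = ‖f ((T ^ (n + 1)) (x n)) - f (x n)‖ := congrArg norm hs
      _ ≤ ‖f ((T ^ (n + 1)) (x n))‖ + ‖f (x n)‖ := norm_sub_le _ _
      _ ≤ 2 * ‖f‖ := by
        have := f.norm_coe_le_norm ((T ^ (n + 1)) (x n))
        have := f.norm_coe_le_norm (x n)
        linarith

/-- If every length had a bad starting point, a limit of the empirical measures on the bad segments
would be an invariant measure with nonpositive integral. This turns inequalities between integrals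
into combinatorics on orbit segments of one fixed length. -/
theorem exists_forall_orbit_sum_pos (T : X ≃ₜ X) (f : C(X, ℤ))
    (hf : ∀ μ ∈ invariantMeasures T, 0 < intMean μ f) :
    ∃ n : ℕ, ∀ x, 0 < ∑ i ∈ Finset.range n, f ((T ^ i) x) := by
  by_contra! h
  choose x hx using fun n => h (n + 1)
  obtain ⟨μ, hμ, U, hU, hlim⟩ := exists_invariantMeasure_of_orbit_segments T x
  have h1 := hlim ⟨fun y => (f y : ℝ), by fun_prop⟩
  have h2 : intMean μ f ≤ 0 := by
    refine le_of_tendsto h1 (Eventually.of_forall fun n => ?_)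
    have : (∑ i ∈ Finset.range (n + 1), (f ((T ^ i) (x n)) : ℝ)) ≤ 0 := by exact_mod_cast hx n
    exact mul_nonpos_of_nonneg_of_nonpos (by positivity) this
  exact absurd (hf μ hμ) (not_lt.2 h2)

theorem invariantMeasures_nonempty (T : X ≃ₜ X) : (invariantMeasures T).Nonempty := by
  obtain ⟨x⟩ := IsCantorSpace.nonempty (X := X)
  obtain ⟨μ, hμ, -⟩ := exists_invariantMeasure_of_orbit_segments T fun _ => x
  exact ⟨μ, hμ⟩

end UniformPositivity

/-! ### Indicators of clopen sets -/

section Indicator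

variable {X : Type*} [TopologicalSpace X]

open Classical in
/-- The indicator function of a clopen set. -/
noncomputable def clopenInd (A : Set X) (hA : IsClopen A) : C(X, ℤ) where
  toFun x := if x ∈ A then 1 else 0
  continuous_toFun := continuous_const.if
    (fun x hx => by
      have hx : x ∈ frontier A := hx
      rw [hA.frontier_eq] at hx
      exact hx.elim) continuous_const

theorem clopenInd_of_mem {A : Set X} (hA : IsClopen A) {x : X} (hx : x ∈ A) :
    clopenInd A hA x = 1 := if_pos hx

theorem clopenInd_of_notMem {A : Set X} (hA : IsClopen A) {x : X} (hx : x ∉ A) :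
    clopenInd A hA x = 0 := if_neg hx

theorem clopenInd_nonneg {A : Set X} (hA : IsClopen A) (x : X) : 0 ≤ clopenInd A hA x := by
  by_cases hx : x ∈ A
  · simp [clopenInd_of_mem hA hx]
  · simp [clopenInd_of_notMem hA hx]

theorem clopenInd_le_one {A : Set X} (hA : IsClopen A) (x : X) : clopenInd A hA x ≤ 1 := by
  by_cases hx : x ∈ A
  · simp [clopenInd_of_mem hA hx]
  · simp [clopenInd_of_notMem hA hx]

theorem clopenInd_pos_iff {A : Set X} (hA : IsClopen A) {x : X} :
    0 < clopenInd A hA x ↔ x ∈ A := by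
  by_cases hx : x ∈ A
  · simp [clopenInd_of_mem hA hx, hx]
  · simp [clopenInd_of_notMem hA hx, hx]

theorem clopenInd_add_diff {A B : Set X} (hA : IsClopen A) (hB : IsClopen B) (h : B ⊆ A) :
    clopenInd B hB + clopenInd (A \ B) (hA.diff hB) = clopenInd A hA := by
  ext x
  by_cases hx : x ∈ B
  · simp [clopenInd, hx, h hx]
  · by_cases hxA : x ∈ A <;> simp [clopenInd, hx, hxA]

/-- Only the values `0` and `1` are possible. This is how comparison of functions produces clopen
subsets. -/
theorem exists_eq_clopenInd {f : C(X, ℤ)} {A : Set X} (hA : IsClopen A) (h0 : ∀ x, 0 ≤ f x)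
    (h1 : ∀ x, f x ≤ clopenInd A hA x) :
    ∃ (B : Set X) (hB : IsClopen B), B ⊆ A ∧ f = clopenInd B hB := by
  have hB : IsClopen (f ⁻¹' {1}) := (isClopen_discrete {(1 : ℤ)}).preimage f.continuous
  refine ⟨f ⁻¹' {1}, hB, fun x hx => ?_, ?_⟩
  · rw [← clopenInd_pos_iff hA]
    have := h1 x
    have hx : f x = 1 := hx
    omega
  · ext x
    have := h1 x
    have := h0 x
    have := clopenInd_le_one hA x
    by_cases hx : f x = 1
    · rw [clopenInd_of_mem hB hx, hx]
    · rw [clopenInd_of_notMem hB hx]; omega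

variable [MeasurableSpace X] [BorelSpace X]

theorem intMean_clopenInd (μ : Measure X) {A : Set X} (hA : IsClopen A) :
    intMean μ (clopenInd A hA) = μ.real A := by
  have : (fun x => (clopenInd A hA x : ℝ)) = A.indicator 1 := by
    ext x
    by_cases hx : x ∈ A <;> simp [clopenInd, hx]
  rw [intMean, this, integral_indicator_one hA.isOpen.measurableSet]

end Indicator

/-! ### Full support and absence of atoms -/

section Support

variable {X : Type*} [TopologicalSpace X] [IsCantorSpace X] [MeasurableSpace X] [BorelSpace X]
  {T : X ≃ₜ X}

/-- The translates of `U` cover the space because orbits are dense, so they cannot all be null. -/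
theorem IsMinimalHomeo.measure_pos (hT : IsMinimalHomeo T) {μ : Measure X}
    (hμ : μ ∈ invariantMeasures T) {U : Set X} (hU : IsOpen U) (hne : U.Nonempty) : 0 < μ U := by
  have := hμ.1
  rw [pos_iff_ne_zero]
  intro h0
  have hcov : (Set.univ : Set X) ⊆ ⋃ n : ℤ, (T ^ n : X ≃ₜ X) ⁻¹' U := by
    intro x _
    obtain ⟨_, hy, n, rfl⟩ := (hT x).inter_open_nonempty U hU hne
    exact Set.mem_iUnion.2 ⟨n, hy⟩
  have hz : ∀ n : ℤ, μ ((T ^ n : X ≃ₜ X) ⁻¹' U) = 0 := by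
    have hT' : PreservesInvariant T T := PreservesInvariant.self
    intro n
    rw [← h0]
    obtain ⟨m, rfl | rfl⟩ := Int.eq_nat_or_neg n
    · rw [zpow_natCast]
      exact (hT'.pow m μ hμ).measure_preimage hU.measurableSet.nullMeasurableSet
    · rw [zpow_neg, zpow_natCast]
      exact ((hT'.pow m μ hμ).homeo_symm).measure_preimage hU.measurableSet.nullMeasurableSet
  have h1 := measure_mono_null hcov (measure_iUnion_null hz)
  simp at h1

theorem IsMinimalHomeo.intMean_pos (hT : IsMinimalHomeo T) {μ : Measure X}
    (hμ : μ ∈ invariantMeasures T) {f : C(X, ℤ)} (h0 : ∀ x, 0 ≤ f x) (hf : f ≠ 0) :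
    0 < intMean μ f := by
  have := hμ.1
  obtain ⟨x, hx⟩ : ∃ x, f x ≠ 0 := by
    by_contra! h
    exact hf (ContinuousMap.ext h)
  have hA : IsClopen (f ⁻¹' {0}ᶜ) := (isClopen_discrete _).preimage f.continuous
  have h1 : intMean μ (clopenInd _ hA) ≤ intMean μ f := intMean_mono μ fun y => by
    by_cases hy : y ∈ f ⁻¹' {0}ᶜ
    · rw [clopenInd_of_mem hA hy]
      have := h0 y
      have hy : f y ≠ 0 := hy
      omega
    · rw [clopenInd_of_notMem hA hy]
      exact h0 y
  refine lt_of_lt_of_le ?_ h1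
  rw [intMean_clopenInd]
  exact ENNReal.toReal_pos (hT.measure_pos hμ hA.isOpen ⟨x, hx⟩).ne' (measure_ne_top _ _)

/-- An atom would recur with the same mass at the infinitely many distinct points of its forward
orbit. -/
theorem IsMinimalHomeo.measure_singleton (hT : IsMinimalHomeo T) {μ : Measure X}
    (hμ : μ ∈ invariantMeasures T) (x : X) : μ {x} = 0 := by
  have := hμ.1
  have hT' : PreservesInvariant T T := PreservesInvariant.self
  by_contra h0
  have heq : ∀ n : ℕ, μ {(T ^ n) x} = μ {x} := fun n => by
    rw [← (hT'.pow n μ hμ).measure_preimage (measurableSet_singleton _).nullMeasurableSet]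
    congr 1
    ext y
    simp
  have hdisj : Pairwise (Function.onFun Disjoint fun n : ℕ => ({(T ^ n) x} : Set X)) := by
    intro m n hmn
    rw [Function.onFun, Set.disjoint_singleton]
    exact fun h => hmn (hT.pow_apply_injective h)
  have h1 := measure_iUnion (μ := μ) hdisj fun n => measurableSet_singleton _
  simp only [heq, ENNReal.tsum_const_eq_top_of_ne_zero h0] at h1
  exact measure_ne_top _ _ h1

end Support

/-! ### Greedy matching along orbits and comparison -/

section GreedyMatching

variable {X : Type*} [TopologicalSpace X]

/-- Pull back an integer-valued function along a homeomorphism. -/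
def pullback (g : X ≃ₜ X) (f : C(X, ℤ)) : C(X, ℤ) := f.comp (g : C(X, X))

@[simp] theorem pullback_apply (g : X ≃ₜ X) (f : C(X, ℤ)) (x : X) : pullback g f x = f (g x) := rfl

/-- What is left of `a` and `b` after greedily matching units of `a` at `x` with units of `b` at
`T x`, then at `T ^ 2 x`, and so on for `n` rounds. -/
def greedyRest (T : X ≃ₜ X) (a b : C(X, ℤ)) : ℕ → C(X, ℤ) × C(X, ℤ)
  | 0 => (a, b)
  | n + 1 =>
    let r := greedyRest T a b n
    let m := r.1 ⊓ pullback (T ^ (n + 1)) r.2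
    (r.1 - m, r.2 - pullback (T ^ (n + 1)).symm m)

/-- The units matched in round `n`, located at their position in `a`. -/
def greedyMatch (T : X ≃ₜ X) (a b : C(X, ℤ)) (n : ℕ) : C(X, ℤ) :=
  (greedyRest T a b n).1 ⊓ pullback (T ^ (n + 1)) (greedyRest T a b n).2

variable (T : X ≃ₜ X) (a b : C(X, ℤ))

theorem greedyRest_succ_fst (n : ℕ) :
    (greedyRest T a b (n + 1)).1 = (greedyRest T a b n).1 - greedyMatch T a b n := rfl

theorem greedyRest_succ_snd (n : ℕ) : (greedyRest T a b (n + 1)).2 =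
    (greedyRest T a b n).2 - pullback (T ^ (n + 1)).symm (greedyMatch T a b n) := rfl

theorem greedyMatch_apply (n : ℕ) (x : X) : greedyMatch T a b n x =
    min ((greedyRest T a b n).1 x) ((greedyRest T a b n).2 ((T ^ (n + 1)) x)) := rfl

theorem greedyRest_fst_add_sum (n : ℕ) :
    (greedyRest T a b n).1 + ∑ i ∈ Finset.range n, greedyMatch T a b i = a := by
  induction n with
  | zero => simp [greedyRest]
  | succ n ih => rw [Finset.sum_range_succ, greedyRest_succ_fst]; rw [← ih]; abel_nf; simp [ih]

theorem greedyRest_snd_add_sum (n : ℕ) : (greedyRest T a b n).2 +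
    ∑ i ∈ Finset.range n, pullback (T ^ (i + 1)).symm (greedyMatch T a b i) = b := by
  induction n with
  | zero => simp [greedyRest]
  | succ n ih =>
    rw [Finset.sum_range_succ, greedyRest_succ_snd, add_comm (Finset.sum _ _), ← add_assoc,
      sub_add_cancel, ih]

variable {a b}

theorem greedyRest_nonneg (ha : ∀ x, 0 ≤ a x) (hb : ∀ x, 0 ≤ b x) (n : ℕ) :
    (∀ x, 0 ≤ (greedyRest T a b n).1 x) ∧ ∀ x, 0 ≤ (greedyRest T a b n).2 x := by
  induction n with
  | zero => exact ⟨ha, hb⟩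
  | succ n ih =>
    refine ⟨fun x => ?_, fun x => ?_⟩
    · rw [greedyRest_succ_fst, ContinuousMap.sub_apply, greedyMatch_apply]
      exact sub_nonneg.2 (min_le_left _ _)
    · rw [greedyRest_succ_snd, ContinuousMap.sub_apply, pullback_apply, greedyMatch_apply,
        Homeomorph.apply_symm_apply]
      exact sub_nonneg.2 (min_le_right _ _)

theorem greedyMatch_nonneg (ha : ∀ x, 0 ≤ a x) (hb : ∀ x, 0 ≤ b x) (n : ℕ) (x : X) :
    0 ≤ greedyMatch T a b n x :=
  le_min ((greedyRest_nonneg T ha hb n).1 x) ((greedyRest_nonneg T ha hb n).2 _)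

/-- If some unit of `a` at `x` is unmatched after `n` rounds, then all units of `b` on the orbit
segment `T x, …, T ^ n x` are matched with units of `a` on the segment `x, …, T ^ (n - 1) x`. -/
theorem sum_lt_sum_of_greedyRest_pos (ha : ∀ x, 0 ≤ a x) (hb : ∀ x, 0 ≤ b x) {n : ℕ} (hn : 0 < n)
    {x : X} (hx : 0 < (greedyRest T a b n).1 x) :
    ∑ i ∈ Finset.range n, b ((T ^ (i + 1)) x) < ∑ i ∈ Finset.range n, a ((T ^ i) x) := by
  have hanti : Antitone fun k => (greedyRest T a b k).1 x :=
    antitone_nat_of_succ_le fun k => by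
      rw [greedyRest_succ_fst, ContinuousMap.sub_apply]
      have := greedyMatch_nonneg T ha hb k x
      omega
  -- A unit of `a` at `x` survives round `k`, so the minimum there was what remained of `b` at `T ^
  -- (k + 1) x`, and that point is exhausted. Its units matched in round `d` came from `T ^ (k - d)
  -- x`.
  have hexh : ∀ k < n, b ((T ^ (k + 1)) x) =
      ∑ d ∈ Finset.range (k + 1), greedyMatch T a b d ((T ^ (k - d)) x) := by
    intro k hk
    have h1 : 0 < (greedyRest T a b (k + 1)).1 x := hx.trans_le (hanti hk)
    have h2 : (greedyRest T a b (k + 1)).2 ((T ^ (k + 1)) x) = 0 := by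
      rw [greedyRest_succ_fst, ContinuousMap.sub_apply, greedyMatch_apply] at h1
      rw [greedyRest_succ_snd, ContinuousMap.sub_apply, pullback_apply, greedyMatch_apply,
        Homeomorph.symm_apply_apply]
      omega
    have h3 := DFunLike.congr_fun (greedyRest_snd_add_sum T a b (k + 1)) ((T ^ (k + 1)) x)
    rw [ContinuousMap.add_apply, h2, zero_add, ContinuousMap.sum_apply] at h3
    rw [← h3]
    refine Finset.sum_congr rfl fun d hd => ?_
    rw [pullback_apply]
    congr 1
    rw [Homeomorph.symm_apply_eq, Homeomorph.pow_apply_pow_apply]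
    congr 2
    have := Finset.mem_range.1 hd
    omega
  calc ∑ i ∈ Finset.range n, b ((T ^ (i + 1)) x)
      = ∑ k ∈ Finset.range n, ∑ d ∈ Finset.range (k + 1),
          greedyMatch T a b d ((T ^ (k - d)) x) :=
        Finset.sum_congr rfl fun k hk => hexh k (Finset.mem_range.1 hk)
    _ = ∑ d ∈ Finset.range n, ∑ i ∈ Finset.range (n - d), greedyMatch T a b d ((T ^ i) x) :=
        Finset.sum_range_diag_flip n fun d i => greedyMatch T a b d ((T ^ i) x)
    _ ≤ ∑ d ∈ Finset.range n, ∑ i ∈ Finset.range n, greedyMatch T a b d ((T ^ i) x) := by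
        refine Finset.sum_le_sum fun d _ => Finset.sum_le_sum_of_subset_of_nonneg ?_ ?_
        · exact Finset.range_subset_range.2 (Nat.sub_le _ _)
        · exact fun i _ _ => greedyMatch_nonneg T ha hb d _
    _ = ∑ i ∈ Finset.range n, ∑ d ∈ Finset.range n, greedyMatch T a b d ((T ^ i) x) :=
        Finset.sum_comm
    _ < ∑ i ∈ Finset.range n, a ((T ^ i) x) := by
        -- The matched amount is at most `a` everywhere, and strictly less at `x`, where a unit is
        -- left over.
        have h4 : ∀ y, (∑ d ∈ Finset.range n, greedyMatch T a b d y) =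
            a y - (greedyRest T a b n).1 y := fun y => by
          have := DFunLike.congr_fun (greedyRest_fst_add_sum T a b n) y
          rw [ContinuousMap.add_apply, ContinuousMap.sum_apply] at this
          omega
        refine Finset.sum_lt_sum (fun i _ => ?_) ⟨0, Finset.mem_range.2 hn, ?_⟩
        · rw [h4]
          have := (greedyRest_nonneg T ha hb n).1 ((T ^ i) x)
          omega
        · rw [h4]
          simpa using hx

variable [IsCantorSpace X] [MeasurableSpace X] [BorelSpace X]

/-- Comparison: if `∫ a < ∫ b` for all invariant measures, then `a` can be moved below `b`
by finitely many positive powers of `T`. -/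
theorem exists_positive_transport (ha : ∀ x, 0 ≤ a x) (hb : ∀ x, 0 ≤ b x)
    (hab : ∀ μ ∈ invariantMeasures T, intMean μ a < intMean μ b) :
    ∃ (N : ℕ) (m : ℕ → C(X, ℤ)), (∀ i x, 0 ≤ m i x) ∧ ∑ i ∈ Finset.range N, m i = a ∧
      ∀ x, (∑ i ∈ Finset.range N, pullback (T ^ (i + 1)).symm (m i)) x ≤ b x := by
  -- Targets start at `T x` rather than at `x`, so positivity is needed for `b ∘ T - a`. An
  -- unmatched unit after `n` rounds would then contradict it.
  obtain ⟨n, hn⟩ := exists_forall_orbit_sum_pos T (pullback T b - a) fun μ hμ => by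
    have := hμ.1
    rw [intMean_sub, pullback, intMean_comp (measurePreserving_of_mem hμ)]
    linarith [hab μ hμ]
  obtain ⟨x₀⟩ := IsCantorSpace.nonempty (X := X)
  have hn0 : 0 < n := by
    rcases Nat.eq_zero_or_pos n with rfl | h
    · simpa using hn x₀
    · exact h
  refine ⟨n, greedyMatch T a b, greedyMatch_nonneg T ha hb, ?_, fun x => ?_⟩
  · have h0 : (greedyRest T a b n).1 = 0 := by
      ext x
      by_contra hx
      have hpos : 0 < (greedyRest T a b n).1 x :=
        lt_of_le_of_ne ((greedyRest_nonneg T ha hb n).1 x) (Ne.symm hx)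
      have h1 := sum_lt_sum_of_greedyRest_pos T ha hb hn0 hpos
      have h2 := hn x
      simp only [ContinuousMap.sub_apply, pullback_apply, Finset.sum_sub_distrib] at h2
      have h3 : ∀ i, T ((T ^ i) x) = (T ^ (i + 1)) x := fun i => by rw [pow_succ']; rfl
      simp only [h3] at h2
      omega
    have := greedyRest_fst_add_sum T a b n
    rwa [h0, zero_add] at this
  · have := DFunLike.congr_fun (greedyRest_snd_add_sum T a b n) x
    rw [ContinuousMap.add_apply] at this
    have := (greedyRest_nonneg T ha hb n).2 x
    omega

/-- Take for `c` the transported copy of `a`; the powers of `T` used do not change integrals. -/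
theorem exists_le_intMean_eq (ha : ∀ x, 0 ≤ a x) (hb : ∀ x, 0 ≤ b x)
    (hab : ∀ μ ∈ invariantMeasures T, intMean μ a < intMean μ b) :
    ∃ c : C(X, ℤ), (∀ x, 0 ≤ c x) ∧ (∀ x, c x ≤ b x) ∧
      ∀ μ ∈ invariantMeasures T, intMean μ c = intMean μ a := by
  obtain ⟨N, m, hm, hma, hmb⟩ := exists_positive_transport T ha hb hab
  refine ⟨_, fun x => ?_, hmb, fun μ hμ => ?_⟩
  · rw [ContinuousMap.sum_apply]
    exact Finset.sum_nonneg fun i _ => hm i _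
  · have := hμ.1
    rw [← hma, intMean_sum, intMean_sum]
    refine Finset.sum_congr rfl fun i _ => intMean_comp ?_ _
    exact (PreservesInvariant.self.pow _).symm μ hμ

end GreedyMatching

/-! ### The order on the group modulo infinitesimals -/

section Order

variable {X : Type*} [TopologicalSpace X] [IsCantorSpace X] [MeasurableSpace X] [BorelSpace X]
  {T : X ≃ₜ X}

theorem dimClass_surjective (T : X ≃ₜ X) : Function.Surjective (dimClass T) :=
  (QuotientAddGroup.mk'_surjective _).comp (QuotientAddGroup.mk'_surjective _)

theorem coboundaries_le_infFunctions (T : X ≃ₜ X) : coboundaries T ≤ infFunctions T := by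
  rintro _ ⟨f, rfl⟩ μ hμ
  have := hμ.1
  change intMean μ (f - f.comp (T : C(X, X))) = 0
  rw [intMean_sub, intMean_comp (measurePreserving_of_mem hμ), sub_self]

/-- Coboundaries have zero integrals, so the two successive quotients amount to one quotient by the
functions whose integrals all vanish. -/
theorem dimClass_eq_zero_iff {f : C(X, ℤ)} :
    dimClass T f = 0 ↔ ∀ μ ∈ invariantMeasures T, intMean μ f = 0 := by
  change (QuotientAddGroup.mk' (infSubgroup T)) (QuotientAddGroup.mk' (coboundaries T) f) = 0 ↔
    f ∈ infFunctions T
  rw [QuotientAddGroup.mk'_apply, QuotientAddGroup.eq_zero_iff]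
  constructor
  · rintro ⟨g, hg, hgf⟩
    rw [QuotientAddGroup.mk'_apply, QuotientAddGroup.mk'_apply, QuotientAddGroup.eq] at hgf
    have := (infFunctions T).add_mem hg (coboundaries_le_infFunctions T hgf)
    rwa [add_neg_cancel_left] at this
  · exact fun h => ⟨f, h, rfl⟩

theorem dimClass_sub (f g : C(X, ℤ)) : dimClass T (f - g) = dimClass T f - dimClass T g :=
  map_sub (dimClass T) f g

theorem dimClass_eq_iff {f g : C(X, ℤ)} :
    dimClass T f = dimClass T g ↔ ∀ μ ∈ invariantMeasures T, intMean μ f = intMean μ g := by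
  rw [← sub_eq_zero, ← dimClass_sub, dimClass_eq_zero_iff]
  refine forall₂_congr fun μ hμ => ?_
  have := hμ.1
  rw [intMean_sub, sub_eq_zero]

/-- Forwards, a nonzero nonnegative function has positive integrals by minimality. Backwards,
comparison moves the negative part of `g - f` below its positive part; subtracting leaves a
nonnegative representative. -/
theorem coneLT_dimClass_iff (hT : IsMinimalHomeo T) {f g : C(X, ℤ)} :
    coneLT (posCone T) (dimClass T f) (dimClass T g) ↔
      ∀ μ ∈ invariantMeasures T, intMean μ f < intMean μ g := by
  constructor
  · rintro ⟨⟨k, hk, hkfg⟩, h0⟩ μ hμ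
    have := hμ.1
    rw [← dimClass_sub, dimClass_eq_iff] at hkfg
    have hk0 : k ≠ 0 := by
      rintro rfl
      refine h0 ?_
      rw [Set.mem_singleton_iff, ← dimClass_sub, ← map_zero (dimClass T), dimClass_eq_iff]
      exact fun μ hμ => (hkfg μ hμ).symm
    have h1 := hT.intMean_pos hμ hk hk0
    rw [hkfg μ hμ, intMean_sub] at h1
    linarith
  · intro h
    let d := g - f
    have hd : ∀ x, (d ⊔ 0) x - (-d ⊔ 0) x = d x := fun x => by
      simp only [ContinuousMap.sup_apply, ContinuousMap.neg_apply, ContinuousMap.zero_apply]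
      omega
    have hd' : d ⊔ 0 - (-d ⊔ 0) = d := ContinuousMap.ext hd
    have hdμ : ∀ μ ∈ invariantMeasures T, 0 < intMean μ d := fun μ hμ => by
      have := hμ.1
      have := h μ hμ
      rw [intMean_sub]; linarith
    obtain ⟨c, hc0, hc, hcμ⟩ := exists_le_intMean_eq T (a := -d ⊔ 0) (b := d ⊔ 0)
      (fun x => le_max_right _ _) (fun x => le_max_right _ _) fun μ hμ => by
        have := hμ.1
        have h1 := hdμ μ hμ
        rw [← hd', intMean_sub] at h1
        linarith
    refine ⟨⟨d ⊔ 0 - c, fun x => sub_nonneg.2 (hc x), ?_⟩, ?_⟩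
    · rw [← dimClass_sub, dimClass_eq_iff]
      intro μ hμ
      have := hμ.1
      change _ = intMean μ d
      rw [intMean_sub, hcμ μ hμ, ← intMean_sub, hd']
    · rw [Set.mem_singleton_iff, ← dimClass_sub, ← map_zero (dimClass T), dimClass_eq_iff]
      intro h0
      obtain ⟨μ, hμ⟩ := invariantMeasures_nonempty T
      have h1 := hdμ μ hμ
      have h2 : intMean μ d = intMean μ 0 := h0 μ hμ
      have := hμ.1
      rw [intMean_zero] at h2
      linarith

theorem coneLT_zero_dimClass_iff (hT : IsMinimalHomeo T) {f : C(X, ℤ)} :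
    coneLT (posCone T) 0 (dimClass T f) ↔ ∀ μ ∈ invariantMeasures T, 0 < intMean μ f := by
  rw [← map_zero (dimClass T), coneLT_dimClass_iff hT]
  refine forall₂_congr fun μ hμ => ?_
  have := hμ.1
  rw [intMean_zero]

end Order

/-! ### Maps that are piecewise measure preserving -/

section Piecewise

variable {X : Type*} [TopologicalSpace X] [IsCantorSpace X] [MeasurableSpace X] [BorelSpace X]

/-- An injective measurable map which almost everywhere agrees with one of countably many
measure-preserving homeomorphisms is measure preserving. -/
theorem measurePreserving_of_piecewise {μ : Measure X} [IsProbabilityMeasure μ] {G : X → X}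
    (hG : Measurable G) (hinj : Function.Injective G) (g : ℕ → X ≃ₜ X)
    (hg : ∀ n, MeasurePreserving (g n) μ μ) (N : Set X) (hN : μ N = 0)
    (hpw : ∀ x, x ∉ N → ∃ n, G x = g n x) : MeasurePreserving G μ μ := by
  -- The pieces are cut from the sets where `G` and `g n` agree, which are measurable in any case; a
  -- choice of index `n` at each point need not be.
  have hE : ∀ n, MeasurableSet {x | G x = g n x} := fun n =>
    measurableSet_eq_fun hG (g n).continuous.measurable
  set D := disjointed fun n => {x | G x = g n x} with hD
  have hDm : ∀ n, MeasurableSet (D n) := fun n => MeasurableSet.disjointed hE n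
  have hDE : ∀ n, ∀ x ∈ D n, G x = g n x := fun n x hx => disjointed_subset _ n hx
  have himg : ∀ n, g n '' D n = G '' D n := fun n =>
    Set.image_congr fun x hx => (hDE n x hx).symm
  have himgm : ∀ n, MeasurableSet (g n '' D n) := fun n =>
    (g n).measurableEmbedding.measurableSet_image.2 (hDm n)
  have hdisj : Pairwise (Function.onFun Disjoint fun n => g n '' D n) := by
    intro m n hmn
    simp only [Function.onFun, himg]
    exact (Set.disjoint_image_iff hinj).2 (disjoint_disjointed _ hmn)
  have hle : ∀ A, MeasurableSet A → μ (G ⁻¹' A) ≤ μ A := by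
    intro A hA
    have hsub : G ⁻¹' A ⊆ (⋃ n, g n ⁻¹' (g n '' D n ∩ A)) ∪ N := by
      intro x hx
      by_cases hxN : x ∈ N
      · exact Or.inr hxN
      · left
        have : x ∈ ⋃ n, D n := by
          rw [hD, iUnion_disjointed]
          exact Set.mem_iUnion.2 (hpw x hxN)
        obtain ⟨n, hn⟩ := Set.mem_iUnion.1 this
        exact Set.mem_iUnion.2 ⟨n, ⟨x, hn, rfl⟩, by rw [← hDE n x hn]; exact hx⟩
    calc μ (G ⁻¹' A) ≤ μ (⋃ n, g n ⁻¹' (g n '' D n ∩ A)) + μ N :=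
          (measure_mono hsub).trans (measure_union_le _ _)
      _ ≤ ∑' n, μ (g n ⁻¹' (g n '' D n ∩ A)) := by
          rw [hN, add_zero]; exact measure_iUnion_le _
      _ = ∑' n, μ (g n '' D n ∩ A) := by
          congr 1 with n
          exact (hg n).measure_preimage ((himgm n).inter hA).nullMeasurableSet
      _ = μ (⋃ n, (g n '' D n ∩ A)) :=
          (measure_iUnion (fun m n hmn => (hdisj hmn).mono Set.inter_subset_left
            Set.inter_subset_left) fun n => (himgm n).inter hA).symm
      _ ≤ μ A := measure_mono (Set.iUnion_subset fun n => Set.inter_subset_right)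
  refine ⟨hG, Measure.ext fun A hA => ?_⟩
  rw [Measure.map_apply hG hA]
  refine le_antisymm (hle A hA) ?_
  -- For a probability measure the inequality on complements is the reverse inequality.
  have h1 := hle Aᶜ hA.compl
  rw [Set.preimage_compl, prob_compl_eq_one_sub hA, prob_compl_eq_one_sub (hG hA)] at h1
  exact (ENNReal.sub_le_sub_iff_left prob_le_one ENNReal.one_ne_top).1 h1

variable {T : X ≃ₜ X}

/-- A continuous injection which off an invariantly null set is piecewise given by countably many
homeomorphisms preserving the invariant measures is itself such a homeomorphism. -/
theorem exists_homeomorph_of_piecewise (hT : IsMinimalHomeo T) {G : X → X} (hG : Continuous G)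
    (hinj : Function.Injective G) (g : ℕ → X ≃ₜ X) (hg : ∀ n, PreservesInvariant T (g n))
    (N : Set X) (hN : ∀ μ ∈ invariantMeasures T, μ N = 0)
    (hpw : ∀ x, x ∉ N → ∃ n, G x = g n x) :
    ∃ F : X ≃ₜ X, ⇑F = G ∧ PreservesInvariant T F := by
  have hpres : PreservesInvariant T G := fun μ hμ => by
    have := hμ.1
    exact measurePreserving_of_piecewise hG.measurable hinj g (fun n => hg n μ hμ) N (hN μ hμ) hpw
  -- The complement of the image is open and null, hence empty because invariant measures have full
  -- support.
  have hsurj : Function.Surjective G := by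
    rw [← Set.range_eq_univ, ← Set.compl_empty_iff]
    by_contra hne
    obtain ⟨μ, hμ⟩ := invariantMeasures_nonempty T
    have hopen : IsOpen (Set.range G)ᶜ := (isCompact_range hG).isClosed.isOpen_compl
    have h1 := hT.measure_pos hμ hopen (Set.nonempty_iff_ne_empty.2 hne)
    rw [← (hpres μ hμ).measure_preimage hopen.measurableSet.nullMeasurableSet] at h1
    simp at h1
  let e : X ≃ X := Equiv.ofBijective G ⟨hinj, hsurj⟩
  have he : Continuous e := hG
  exact ⟨he.homeoOfEquivCompactToT2, rfl, hpres⟩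

end Piecewise

/-! ### From speedups to measures, and from measures to the group -/

section Implications

variable {X Y : Type*}
    [TopologicalSpace X] [IsCantorSpace X] [MeasurableSpace X] [BorelSpace X]
    [TopologicalSpace Y] [IsCantorSpace Y] [MeasurableSpace Y] [BorelSpace Y]
    {T : X ≃ₜ X} {S : Y ≃ₜ Y}

theorem map_mem_invariantMeasures {F : X ≃ₜ Y} {μ : Measure X} (hμ : μ ∈ invariantMeasures T)
    (hF : MeasurePreserving ((F.trans S).trans F.symm) μ μ) :
    μ.map F ∈ invariantMeasures S := by
  have := hμ.1
  refine ⟨Measure.isProbabilityMeasure_map F.continuous.aemeasurable, fun A hA => ?_⟩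
  rw [Measure.map_apply F.continuous.measurable (S.continuous.measurable hA),
    Measure.map_apply F.continuous.measurable hA,
    ← hF.measure_preimage (F.continuous.measurable hA).nullMeasurableSet]
  congr 1
  ext x
  simp

/-- Pushing forward by `F.symm` undoes the pushforward, so the injectivity in the third condition is
automatic. -/
theorem injOn_map_homeomorph (F : X ≃ₜ Y) (s : Set (Measure X)) :
    Set.InjOn (fun μ : Measure X => μ.map F) s := by
  intro μ _ ν _ h
  have := congrArg (Measure.map F.symm) h
  simp only at this
  rwa [Measure.map_map F.symm.continuous.measurable F.continuous.measurable,
    Measure.map_map F.symm.continuous.measurable F.continuous.measurable,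
    Homeomorph.symm_comp_self, Measure.map_id, Measure.map_id] at this

/-- The conjugate of `S` on `X` is at each point some power of `T`, so it preserves every
`T`-invariant measure. -/
theorem IsSpeedup.exists_mapsTo (h : IsSpeedup S T) : ∃ F : X ≃ₜ Y,
    Set.MapsTo (fun μ : Measure X => μ.map F) (invariantMeasures T) (invariantMeasures S) := by
  obtain ⟨p, -, F, hF⟩ := h
  refine ⟨F, fun μ hμ => map_mem_invariantMeasures hμ ?_⟩
  have := hμ.1
  refine measurePreserving_of_piecewise (Homeomorph.continuous _).measurable
    (Homeomorph.injective _) (fun n => T ^ n) (fun n => PreservesInvariant.self.pow n μ hμ) ∅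
    measure_empty fun x _ => ⟨p x, ?_⟩
  simp only [Homeomorph.trans_apply]
  rw [Homeomorph.pow_apply_eq_iterate, ← hF, Homeomorph.symm_apply_apply]

theorem intMean_map (F : X ≃ₜ Y) (μ : Measure X) (f : C(Y, ℤ)) :
    intMean (μ.map F) f = intMean μ (f.comp (F : C(X, Y))) :=
  F.measurableEmbedding.integral_map _

/-- Composition with `F` respects infinitesimals because pushed-forward measures are `S`-invariant.
For exhaustiveness, comparison for `T` moves a representative of `h` below `f ∘ F`, and the result
is carried back to `Y`. -/
theorem exists_exhaustive_of_mapsTo (hT : IsMinimalHomeo T) (hS : IsMinimalHomeo S) (F : X ≃ₜ Y)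
    (hF : Set.MapsTo (fun μ : Measure X => μ.map F) (invariantMeasures T) (invariantMeasures S)) :
    ∃ φ : DimGroupModInf S →+ DimGroupModInf T,
      IsExhaustiveUnitalEpi (posCone S) (orderUnit S) (posCone T) (orderUnit T) φ := by
  let c : C(Y, ℤ) →+ C(X, ℤ) :=
    { toFun := fun f => f.comp (F : C(X, Y)), map_zero' := rfl, map_add' := fun _ _ => rfl }
  let ψ : C(Y, ℤ) →+ DimGroupModInf T := (dimClass T).comp c
  have hψ : ∀ f, dimClass S f = 0 → ψ f = 0 := fun f hf => by
    rw [dimClass_eq_zero_iff] at hf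
    exact dimClass_eq_zero_iff.2 fun μ hμ => by
      have := hf _ (hF hμ)
      rwa [intMean_map] at this
  let ψ₁ : DimGroup S →+ DimGroupModInf T := QuotientAddGroup.lift (coboundaries S) ψ fun f hf =>
    hψ f (dimClass_eq_zero_iff.2 (coboundaries_le_infFunctions S hf))
  let φ : DimGroupModInf S →+ DimGroupModInf T := QuotientAddGroup.lift (infSubgroup S) ψ₁ (by
    rintro _ ⟨f, hf, rfl⟩
    exact hψ f (dimClass_eq_zero_iff.2 hf))
  have hφ : ∀ f, φ (dimClass S f) = dimClass T (f.comp (F : C(X, Y))) := fun f => rfl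
  have hcF : ∀ k : C(X, ℤ), (k.comp (F.symm : C(Y, X))).comp (F : C(X, Y)) = k := fun k => by
    ext x; simp
  refine ⟨φ, ⟨fun b => ?_, ?_, ?_, ?_⟩⟩
  · obtain ⟨k, rfl⟩ := dimClass_surjective T b
    exact ⟨dimClass S (k.comp (F.symm : C(Y, X))), by rw [hφ, hcF]⟩
  · rintro _ ⟨f, hf, rfl⟩
    exact ⟨f.comp (F : C(X, Y)), fun x => hf (F x), (hφ f).symm⟩
  · exact (hφ 1).trans rfl
  · rintro _ ⟨f, hf, rfl⟩ h h0 hlt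
    rw [hφ] at hlt
    obtain ⟨⟨k, hk, hkh⟩, -⟩ := id h0
    rw [sub_zero] at hkh
    subst hkh
    rw [coneLT_zero_dimClass_iff hT] at h0
    rw [coneLT_dimClass_iff hT] at hlt
    obtain ⟨m, hm0, hmf, hmk⟩ := exists_le_intMean_eq T hk (fun x => hf (F x)) hlt
    obtain ⟨μ, hμ⟩ := invariantMeasures_nonempty T
    have := hμ.1
    -- The bounds `0 ≤ m' ≤ f` are pointwise and neither is an equality, so minimality of `S` makes
    -- them strict for every `S`-invariant measure, including those not coming from `X`.
    let m' := m.comp (F.symm : C(Y, X))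
    refine ⟨dimClass S m', ?_, ?_, ?_⟩
    · rw [hφ, hcF]
      exact dimClass_eq_iff.2 hmk
    · rw [coneLT_zero_dimClass_iff hS]
      refine fun ν hν => hS.intMean_pos hν (fun y => hm0 _) fun hz => ?_
      have : m = 0 := by rw [← hcF m]; change m'.comp _ = 0; rw [hz]; rfl
      have h1 := hmk μ hμ
      rw [this, intMean_zero] at h1
      exact absurd (h0 μ hμ) (by rw [← h1]; exact lt_irrefl _)
    · rw [coneLT_dimClass_iff hS]
      intro ν hν
      have := hν.1
      have h2 : 0 < intMean ν (f - m') := by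
        refine hS.intMean_pos hν (fun y => ?_) fun hz => ?_
        · have := hmf (F.symm y)
          simp only [ContinuousMap.comp_apply, ContinuousMap.coe_coe,
            Homeomorph.apply_symm_apply] at this
          exact sub_nonneg.2 this
        · have h3 := hlt μ hμ
          rw [sub_eq_zero.1 hz, ← hmk μ hμ, hcF] at h3
          exact lt_irrefl _ h3
      rw [intMean_sub] at h2
      linarith

end Implications

/-! ### Stone duality for Cantor spaces -/

section ClopenDuality

open TopologicalSpace

variable {X Y : Type*} [TopologicalSpace X] [IsCantorSpace X] [TopologicalSpace Y] [IsCantorSpace Y]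

theorem IsCantorSpace.eq_of_forall_clopens {x y : X} (h : ∀ V : Clopens X, x ∈ V ↔ y ∈ V) :
    x = y := by
  by_contra hne
  obtain ⟨V, hV, hx, hy⟩ := IsCantorSpace.exists_isClopen_mem_notMem hne
  exact hy ((h ⟨V, hV⟩).1 hx)

/-- The clopen sets `V` with `x ∈ Φ V` form an ultrafilter of the clopen algebra, and compactness
gives it a point. -/
theorem exists_mem_iff_of_clopens_orderIso (Φ : Clopens Y ≃o Clopens X) (x : X) :
    ∃ y, ∀ V : Clopens Y, y ∈ V ↔ x ∈ Φ V := by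
  have hne : (⋂ V : {V : Clopens Y // x ∈ Φ V}, (V.1 : Set Y)).Nonempty := by
    have : Nonempty {V : Clopens Y // x ∈ Φ V} := ⟨⟨⊤, by rw [map_top]; trivial⟩⟩
    refine IsCompact.nonempty_iInter_of_directed_nonempty_isCompact_isClosed _ ?_ ?_
      (fun V => V.1.isClopen.isClosed.isCompact) fun V => V.1.isClopen.isClosed
    · intro V W
      exact ⟨⟨V.1 ⊓ W.1, by rw [map_inf]; exact ⟨V.2, W.2⟩⟩, Set.inter_subset_left,
        Set.inter_subset_right⟩
    · intro V
      by_contra h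
      have h1 : V.1 = ⊥ := Clopens.ext (Set.not_nonempty_iff_eq_empty.1 h)
      have h2 := V.2
      rw [h1, map_bot] at h2
      exact h2
  obtain ⟨y, hy⟩ := hne
  have hmem : ∀ V : Clopens Y, x ∈ Φ V → y ∈ V := fun V hV => Set.mem_iInter.1 hy ⟨V, hV⟩
  refine ⟨y, fun V => ⟨fun h => ?_, hmem V⟩⟩
  by_contra hx
  have h1 : x ∈ Φ Vᶜ := by rw [map_compl]; exact hx
  exact hmem _ h1 h

theorem exists_homeomorph_of_clopens_orderIso (Φ : Clopens Y ≃o Clopens X) :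
    ∃ h : X ≃ₜ Y, ∀ V : Clopens Y, h ⁻¹' V = Φ V := by
  choose f hf using exists_mem_iff_of_clopens_orderIso Φ
  choose g hg using exists_mem_iff_of_clopens_orderIso Φ.symm
  have hpre : ∀ V : Clopens Y, f ⁻¹' V = Φ V := fun V => Set.ext fun x => hf x V
  refine ⟨⟨⟨f, g, fun x => IsCantorSpace.eq_of_forall_clopens fun V => ?_,
    fun y => IsCantorSpace.eq_of_forall_clopens fun V => ?_⟩, ?_, ?_⟩, hpre⟩
  · rw [hg, hf, OrderIso.apply_symm_apply]
  · rw [hf, hg, OrderIso.symm_apply_apply]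
  · exact (IsCantorSpace.isTopologicalBasis_isClopen (X := Y)).continuous_iff.2
      fun V hV => (hpre ⟨V, hV⟩) ▸ (Φ ⟨V, hV⟩).isClopen.isOpen
  · refine (IsCantorSpace.isTopologicalBasis_isClopen (X := X)).continuous_iff.2 fun V hV => ?_
    have : g ⁻¹' V = Φ.symm ⟨V, hV⟩ := Set.ext fun y => hg y ⟨V, hV⟩
    exact this ▸ (Φ.symm ⟨V, hV⟩).isClopen.isOpen

/-- A correspondence between clopen sets which is total on both sides and respects inclusion is
induced by a homeomorphism. -/
theorem exists_homeomorph_of_clopen_rel (r : Set Y → Set X → Prop)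
    (hclopen : ∀ V W, r V W → IsClopen W)
    (htotY : ∀ V, IsClopen V → ∃ W, r V W) (htotX : ∀ W, IsClopen W → ∃ V, IsClopen V ∧ r V W)
    (hord : ∀ V W V' W', r V W → r V' W' → (V ⊆ V' ↔ W ⊆ W')) :
    ∃ h : X ≃ₜ Y, ∀ V W, IsClopen V → r V W → h ⁻¹' V = W := by
  choose! φ hφ using htotY
  let Φ : Clopens Y ↪o Clopens X := OrderEmbedding.ofMapLEIff
    (fun V => ⟨φ V, hclopen _ _ (hφ V V.isClopen)⟩)
    fun V V' => (hord _ _ _ _ (hφ V V.isClopen) (hφ V' V'.isClopen)).symm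
  have huniq : ∀ V W, IsClopen V → r V W → φ V = W := fun V W hV h =>
    Set.Subset.antisymm ((hord _ _ _ _ (hφ V hV) h).1 subset_rfl)
      ((hord _ _ _ _ h (hφ V hV)).1 subset_rfl)
  have hsurj : Function.Surjective Φ := fun W => by
    obtain ⟨V, hV, h⟩ := htotX W W.isClopen
    exact ⟨⟨V, hV⟩, Clopens.ext (huniq V W hV h)⟩
  obtain ⟨h, hh⟩ := exists_homeomorph_of_clopens_orderIso (RelIso.ofSurjective Φ hsurj)
  exact ⟨h, fun V W hV hr => (hh ⟨V, hV⟩).trans (huniq V W hV hr)⟩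

end ClopenDuality

/-! ### Back-and-forth construction of homeomorphisms -/

section BackAndForth

variable {X Y : Type*} [TopologicalSpace X] [TopologicalSpace Y]

/-- Clopen partitions of `Y` and `X` indexed by `ℕ` whose corresponding pieces are related. -/
structure MatchedLabels (P : Set Y → Set X → Prop) where
  left : Y → ℕ
  right : X → ℕ
  isLocallyConstant_left : IsLocallyConstant left
  isLocallyConstant_right : IsLocallyConstant right
  rel : ∀ k, P (left ⁻¹' {k}) (right ⁻¹' {k})

/-- Exchange the two sides. -/
def MatchedLabels.flip {P : Set Y → Set X → Prop} (l : MatchedLabels P) :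
    MatchedLabels (fun B A => P A B) :=
  ⟨l.right, l.left, l.isLocallyConstant_right, l.isLocallyConstant_left, l.rel⟩

/-- Each piece is split by `C` and its partner is split by `hP`; label `k` becomes `2 * k + 1`
inside `C` and `2 * k` outside. Halving recovers the old label, parity recovers `C`. -/
theorem MatchedLabels.exists_refine {P : Set Y → Set X → Prop}
    (hP : ∀ A B, P A B → ∀ A₁, IsClopen A₁ → A₁ ⊆ A →
      ∃ B₁, IsClopen B₁ ∧ B₁ ⊆ B ∧ P A₁ B₁ ∧ P (A \ A₁) (B \ B₁))
    (l : MatchedLabels P) {C : Set Y} (hC : IsClopen C) :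
    ∃ l' : MatchedLabels P, (∀ y, l.left y = l'.left y / 2) ∧ (∀ x, l.right x = l'.right x / 2) ∧
      C = l'.left ⁻¹' {k | k % 2 = 1} := by
  classical
  have hclopen : ∀ k, IsClopen (l.left ⁻¹' {k} ∩ C) := fun k =>
    (l.isLocallyConstant_left.isClopen_fiber k).inter hC
  choose B hBc hBs hB hB' using fun k => hP _ _ (l.rel k) _ (hclopen k) Set.inter_subset_left
  let a : Y → ℕ := fun y => 2 * l.left y + if y ∈ C then 1 else 0
  let b : X → ℕ := fun x => 2 * l.right x + if x ∈ B (l.right x) then 1 else 0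
  have ha0 : ∀ k, a ⁻¹' {2 * k} = l.left ⁻¹' {k} \ (l.left ⁻¹' {k} ∩ C) := fun k => by
    ext y
    by_cases hy : y ∈ C
    · simp [a, hy]; omega
    · simp [a, hy]
  have ha1 : ∀ k, a ⁻¹' {2 * k + 1} = l.left ⁻¹' {k} ∩ C := fun k => by
    ext y
    by_cases hy : y ∈ C
    · simp [a, hy]
    · simp [a, hy]; omega
  have hb0 : ∀ k, b ⁻¹' {2 * k} = l.right ⁻¹' {k} \ B k := fun k => by
    ext x
    by_cases hx : x ∈ B (l.right x)
    · simp only [b, hx, if_true, Set.mem_preimage, Set.mem_singleton_iff, Set.mem_sdiff]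
      constructor
      · intro h; omega
      · rintro ⟨rfl, h⟩; exact absurd hx h
    · simp only [b, hx, if_false, Set.mem_preimage, Set.mem_singleton_iff, Set.mem_sdiff]
      constructor
      · intro h
        have : l.right x = k := by omega
        subst this
        exact ⟨rfl, hx⟩
      · rintro ⟨rfl, -⟩; rfl
  have hb1 : ∀ k, b ⁻¹' {2 * k + 1} = B k := fun k => by
    ext x
    by_cases hx : x ∈ B (l.right x)
    · simp only [b, hx, if_true, Set.mem_preimage, Set.mem_singleton_iff]
      constructor
      · intro h
        have : l.right x = k := by omega
        subst this
        exact hx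
      · intro h
        have : l.right x = k := hBs k h
        omega
    · simp only [b, hx, if_false, Set.mem_preimage, Set.mem_singleton_iff]
      constructor
      · intro h; omega
      · intro h
        have : l.right x = k := hBs k h
        subst this
        exact absurd h hx
  have hcases : ∀ n : ℕ, ∃ k, n = 2 * k ∨ n = 2 * k + 1 := fun n => ⟨n / 2, by omega⟩
  refine ⟨⟨a, b, IsLocallyConstant.iff_isOpen_fiber.2 fun n => ?_,
    IsLocallyConstant.iff_isOpen_fiber.2 fun n => ?_, fun n => ?_⟩, fun y => ?_, fun x => ?_, ?_⟩
  · obtain ⟨k, rfl | rfl⟩ := hcases n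
    · rw [ha0]; exact ((l.isLocallyConstant_left.isClopen_fiber k).diff (hclopen k)).isOpen
    · rw [ha1]; exact (hclopen k).isOpen
  · obtain ⟨k, rfl | rfl⟩ := hcases n
    · rw [hb0]; exact ((l.isLocallyConstant_right.isClopen_fiber k).diff (hBc k)).isOpen
    · rw [hb1]; exact (hBc k).isOpen
  · obtain ⟨k, rfl | rfl⟩ := hcases n
    · rw [ha0, hb0]; exact hB' k
    · rw [ha1, hb1]; exact hB k
  · simp only [a]; split_ifs <;> omega
  · simp only [b]; split_ifs <;> omega
  · ext y
    by_cases hy : y ∈ C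
    · simp only [a, hy, Set.mem_preimage, Set.mem_ofPred_eq, if_true, true_iff]; omega
    · simp only [a, hy, Set.mem_preimage, Set.mem_ofPred_eq, if_false, false_iff]; omega

/-- Back and forth: a relation between clopen sets that can be refined on both sides is realized
by a homeomorphism. -/
theorem exists_homeomorph_of_back_and_forth [IsCantorSpace X] [IsCantorSpace Y]
    (P : Set Y → Set X → Prop) (huniv : P Set.univ Set.univ)
    (hempty : ∀ A B, P A B → (A = ∅ ↔ B = ∅))
    (hadd : ∀ A B A' B', P A B → P A' B' → Disjoint A A' → Disjoint B B' → P (A ∪ A') (B ∪ B'))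
    (hY : ∀ A B, P A B → ∀ A₁, IsClopen A₁ → A₁ ⊆ A →
      ∃ B₁, IsClopen B₁ ∧ B₁ ⊆ B ∧ P A₁ B₁ ∧ P (A \ A₁) (B \ B₁))
    (hX : ∀ A B, P A B → ∀ B₁, IsClopen B₁ → B₁ ⊆ B →
      ∃ A₁, IsClopen A₁ ∧ A₁ ⊆ A ∧ P A₁ B₁ ∧ P (A \ A₁) (B \ B₁)) :
    ∃ F : X ≃ₜ Y, ∀ A, IsClopen A → P A (F ⁻¹' A) := by
  obtain ⟨V, hV, hVsurj⟩ := IsCantorSpace.exists_isClopen_enumeration Y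
  obtain ⟨W, hW, hWsurj⟩ := IsCantorSpace.exists_isClopen_enumeration X
  have hP0 : P ∅ ∅ := by
    obtain ⟨B, -, -, hB, -⟩ := hY _ _ huniv ∅ isClopen_empty (Set.empty_subset _)
    rwa [(hempty _ _ hB).1 rfl] at hB
  have hstep : ∀ (n : ℕ) (l : MatchedLabels P), ∃ l' : MatchedLabels P,
      (∃ π : ℕ → ℕ, l.left = π ∘ l'.left ∧ l.right = π ∘ l'.right) ∧
      (∃ K, V n = l'.left ⁻¹' K) ∧ ∃ K, W n = l'.right ⁻¹' K := by
    intro n l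
    obtain ⟨l₁, hl₁, hr₁, hC⟩ := l.exists_refine hY (hV n)
    obtain ⟨l₂, hl₂, hr₂, hD⟩ := l₁.flip.exists_refine (fun B A h => hX A B h) (hW n)
    refine ⟨l₂.flip, ⟨fun k => k / 2 / 2, funext fun y => ?_, funext fun x => ?_⟩,
      ⟨{k | k / 2 % 2 = 1}, ?_⟩, ⟨_, hD⟩⟩
    · rw [hl₁ y]; exact congrArg (· / 2) (hr₂ y)
    · rw [hr₁ x]; exact congrArg (· / 2) (hl₂ x)
    · rw [hC]
      ext y
      have := hr₂ y
      exact Iff.of_eq (congrArg (fun t => t % 2 = 1) this)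
  choose next hπ hnV hnW using hstep
  let l₀ : MatchedLabels P := ⟨fun _ => 0, fun _ => 0, IsLocallyConstant.const 0,
    IsLocallyConstant.const 0, fun k => by
      by_cases hk : 0 = k
      · subst hk; simpa using huniv
      · have h1 : (fun _ : Y => 0) ⁻¹' {k} = ∅ := by ext; simp [hk]
        have h2 : (fun _ : X => 0) ⁻¹' {k} = ∅ := by ext; simp [hk]
        rw [h1, h2]; exact hP0⟩
  let l : ℕ → MatchedLabels P := fun n => Nat.rec l₀ (fun n l => next n l) n
  have hl : ∀ n, l (n + 1) = next n (l n) := fun n => rfl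
  have hmono : ∀ n m, n ≤ m → ∃ π : ℕ → ℕ, (l n).left = π ∘ (l m).left ∧
      (l n).right = π ∘ (l m).right := by
    intro n m h
    induction m, h using Nat.le_induction with
    | base => exact ⟨id, rfl, rfl⟩
    | succ m _ ih =>
      obtain ⟨π, h1, h2⟩ := ih
      obtain ⟨π', h3, h4⟩ := hπ m (l m)
      exact ⟨π ∘ π', by rw [h1, h3]; rfl, by rw [h2, h4]; rfl⟩
  -- Two sets correspond when at some stage they are unions of pieces with the same labels.
  -- Inclusions agree on both sides because a label occurs on the left exactly when it occurs on the
  -- right.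
  let r : Set Y → Set X → Prop := fun A B => ∃ n K, A = (l n).left ⁻¹' K ∧ B = (l n).right ⁻¹' K
  have hrmono : ∀ n m, n ≤ m → ∀ K, ∃ K', (l n).left ⁻¹' K = (l m).left ⁻¹' K' ∧
      (l n).right ⁻¹' K = (l m).right ⁻¹' K' := by
    intro n m h K
    obtain ⟨π, h1, h2⟩ := hmono n m h
    exact ⟨π ⁻¹' K, by rw [h1]; rfl, by rw [h2]; rfl⟩
  have hfib : ∀ n k, (∃ y, (l n).left y = k) ↔ ∃ x, (l n).right x = k := fun n k => by
    have := hempty _ _ ((l n).rel k)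
    rw [← Set.not_nonempty_iff_eq_empty, ← Set.not_nonempty_iff_eq_empty, not_iff_not] at this
    exact this
  have hrel : ∃ F : X ≃ₜ Y, ∀ A B, IsClopen A → r A B → F ⁻¹' A = B := by
    refine exists_homeomorph_of_clopen_rel r ?_ ?_ ?_ ?_
    · rintro _ _ ⟨n, K, rfl, rfl⟩
      exact ⟨⟨(l n).isLocallyConstant_right Kᶜ⟩, (l n).isLocallyConstant_right K⟩
    · intro A hA
      obtain ⟨n, rfl⟩ := hVsurj A hA
      obtain ⟨K, hK⟩ := hnV n (l n)
      exact ⟨_, n + 1, K, hK, rfl⟩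
    · intro B hB
      obtain ⟨n, rfl⟩ := hWsurj B hB
      obtain ⟨K, hK⟩ := hnW n (l n)
      exact ⟨_, ⟨⟨(l (n + 1)).isLocallyConstant_left Kᶜ⟩, (l (n + 1)).isLocallyConstant_left K⟩,
        n + 1, K, rfl, hK⟩
    · rintro _ _ _ _ ⟨n, K, rfl, rfl⟩ ⟨m, K', rfl, rfl⟩
      obtain ⟨L, h1, h2⟩ := hrmono n (max n m) (le_max_left _ _) K
      obtain ⟨L', h3, h4⟩ := hrmono m (max n m) (le_max_right _ _) K'
      rw [h1, h2, h3, h4]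
      constructor
      · intro h x hx
        obtain ⟨y, hy⟩ := (hfib _ _).2 ⟨x, rfl⟩
        have : y ∈ (l (max n m)).left ⁻¹' L := by rw [Set.mem_preimage, hy]; exact hx
        have := h this
        rwa [Set.mem_preimage, hy] at this
      · intro h y hy
        obtain ⟨x, hx⟩ := (hfib _ _).1 ⟨y, rfl⟩
        have : x ∈ (l (max n m)).right ⁻¹' L := by rw [Set.mem_preimage, hx]; exact hy
        have := h this
        rwa [Set.mem_preimage, hx] at this
  obtain ⟨F, hF⟩ := hrel
  refine ⟨F, fun A hA => ?_⟩
  obtain ⟨n, rfl⟩ := hVsurj A hA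
  obtain ⟨K, hK⟩ := hnV n (l n)
  have hr : r (V n) ((l (n + 1)).right ⁻¹' K) := ⟨n + 1, K, hK, rfl⟩
  rw [hF _ _ hA hr, hK, ← hl]
  set a := (l (n + 1)).left
  set b := (l (n + 1)).right
  have hfin : ∀ s : Finset ℕ, P (a ⁻¹' s) (b ⁻¹' s) := by
    intro s
    induction s using Finset.induction_on with
    | empty => simpa using hP0
    | insert k s hk ih =>
      rw [Finset.coe_insert, Set.insert_eq, Set.preimage_union, Set.preimage_union]
      exact hadd _ _ _ _ ((l (n + 1)).rel k) ih
        (Disjoint.preimage _ (by simpa using hk)) (Disjoint.preimage _ (by simpa using hk))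
  have hra : (Set.range a).Finite := (l (n + 1)).isLocallyConstant_left.range_finite
  have hrb : (Set.range b).Finite := (l (n + 1)).isLocallyConstant_right.range_finite
  -- The label set `K` may be infinite, but by compactness only finitely many labels occur, so
  -- finite additivity of `P` suffices.
  have hs := ((hra.union hrb).inter_of_right K)
  have := hfin hs.toFinset
  rw [Set.Finite.coe_toFinset] at this
  convert this using 1
  · ext y; simp
  · ext x; simp

end BackAndForth

/-! ### From an exhaustive epimorphism to a homeomorphism -/

section ExhaustiveToHomeomorph

variable {X Y : Type*}
    [TopologicalSpace X] [IsCantorSpace X] [MeasurableSpace X] [BorelSpace X]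
    [TopologicalSpace Y] [IsCantorSpace Y] [MeasurableSpace Y] [BorelSpace Y]
    {T : X ≃ₜ X} {S : Y ≃ₜ Y}

theorem dimClass_add_left_cancel {f g : C(X, ℤ)} {a : DimGroupModInf T}
    (h : dimClass T f + a = dimClass T f + dimClass T g) : a = dimClass T g := by
  obtain ⟨k, rfl⟩ := dimClass_surjective T a
  have h1 : dimClass T (f + k) = dimClass T (f + g) :=
    (map_add (dimClass T) f k).trans (h.trans (map_add (dimClass T) f g).symm)
  refine dimClass_eq_iff.2 fun μ hμ => ?_
  have := hμ.1
  have h2 := dimClass_eq_iff.1 h1 μ hμ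
  rw [intMean_add, intMean_add] at h2
  exact add_left_cancel h2

/-- Back and forth gives `F` such that `φ` sends the class of the indicator of `A` to that of `F ⁻¹'
A`. As `A` and `S ⁻¹' A` have the same class, their preimages have the same measure, which is the
invariance of the pushforward on clopen sets. -/
theorem exists_mapsTo_of_exhaustive (hT : IsMinimalHomeo T) (hS : IsMinimalHomeo S)
    {φ : DimGroupModInf S →+ DimGroupModInf T}
    (hφ : IsExhaustiveUnitalEpi (posCone S) (orderUnit S) (posCone T) (orderUnit T) φ) :
    ∃ F : X ≃ₜ Y,
      Set.MapsTo (fun μ : Measure X => μ.map F) (invariantMeasures T) (invariantMeasures S) := by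
  obtain ⟨μ₀, hμ₀⟩ := invariantMeasures_nonempty T
  have hμ₀' := hμ₀.1
  let ψ : C(Y, ℤ) → DimGroupModInf T := fun f => φ (dimClass S f)
  have hψadd : ∀ f g, ψ (f + g) = ψ f + ψ g := fun f g =>
    (congrArg φ (map_add (dimClass S) f g)).trans (map_add φ _ _)
  have hψzero : ψ 0 = 0 := (congrArg φ (map_zero (dimClass S))).trans (map_zero φ)
  have hψone : ψ 1 = dimClass T 1 := hφ.map_unit
  have hψpos : ∀ f : C(Y, ℤ), (∀ y, 0 ≤ f y) → ∃ k : C(X, ℤ), (∀ x, 0 ≤ k x) ∧ dimClass T k = ψ f :=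
    fun f hf => hφ.map_pos _ ⟨f, hf, rfl⟩
  have hψS : ∀ (g : Y ≃ₜ Y) (f : C(Y, ℤ)), PreservesInvariant S g → ψ (pullback g f) = ψ f :=
    fun g f hg => congrArg φ (dimClass_eq_iff.2 fun ν hν => intMean_comp (hg ν hν) f)
  -- The indicators of finitely many translates of `A` sum to at least `1`, and all have the same
  -- image. If it were zero, positivity would make minus the unit nonnegative.
  have hψne : ∀ (A : Set Y) (hA : IsClopen A), A.Nonempty → ψ (clopenInd A hA) ≠ 0 := by
    intro A hA hne h0
    have hAne : clopenInd A hA ≠ 0 := by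
      obtain ⟨y, hy⟩ := hne
      intro h
      have := clopenInd_of_mem hA hy
      rw [h] at this
      exact zero_ne_one this
    obtain ⟨n, hn⟩ := exists_forall_orbit_sum_pos S (clopenInd A hA) fun ν hν =>
      hS.intMean_pos hν (clopenInd_nonneg hA) hAne
    let s : ℕ → C(Y, ℤ) := fun n => ∑ i ∈ Finset.range n, pullback (S ^ i) (clopenInd A hA)
    have hs : ∀ n, ψ (s n) = 0 := by
      intro n
      induction n with
      | zero => simpa [s] using hψzero
      | succ n ih =>
        have : s (n + 1) = s n + pullback (S ^ n) (clopenInd A hA) := Finset.sum_range_succ _ _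
        rw [this, hψadd, ih, hψS _ _ (PreservesInvariant.self.pow n), h0]
        exact add_zero (0 : DimGroupModInf T)
    obtain ⟨k, hk, hk'⟩ := hψpos (s n - 1) fun y => by
      have := hn y
      simp only [s, ContinuousMap.sub_apply, ContinuousMap.sum_apply, pullback_apply,
        ContinuousMap.one_apply]
      omega
    have h1 : dimClass T (k + 1) = dimClass T 0 := by
      have h2 := hψadd (s n - 1) 1
      rw [sub_add_cancel, hs, ← hk', hψone] at h2
      exact (map_add (dimClass T) k 1).trans (h2.symm.trans (map_zero (dimClass T)).symm)
    have h2 := dimClass_eq_iff.1 h1 μ₀ hμ₀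
    rw [intMean_add, intMean_one, intMean_zero] at h2
    have h3 : intMean μ₀ 0 ≤ intMean μ₀ k := intMean_mono μ₀ hk
    rw [intMean_zero] at h3
    linarith
  let P : Set Y → Set X → Prop := fun A B => ∃ (hA : IsClopen A) (hB : IsClopen B),
    ψ (clopenInd A hA) = dimClass T (clopenInd B hB)
  have hind0 : ∀ {Z : Type _} [TopologicalSpace Z] (h : IsClopen (∅ : Set Z)),
      clopenInd ∅ h = 0 := fun h => ContinuousMap.ext fun _ => clopenInd_of_notMem h id
  have hind0' : ∀ (h : IsClopen (∅ : Set Y)),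
      clopenInd ∅ h = 0 := fun h => ContinuousMap.ext fun _ => clopenInd_of_notMem h id
  have hdiff : ∀ {A A₁ : Set Y} {B B₁ : Set X} (hA : IsClopen A) (hB : IsClopen B)
      (hA₁ : IsClopen A₁) (hB₁ : IsClopen B₁), A₁ ⊆ A → B₁ ⊆ B →
      ψ (clopenInd A hA) = dimClass T (clopenInd B hB) →
      ψ (clopenInd A₁ hA₁) = dimClass T (clopenInd B₁ hB₁) → P (A \ A₁) (B \ B₁) := by
    intro A A₁ B B₁ hA hB hA₁ hB₁ hAs hBs h h₁
    refine ⟨hA.diff hA₁, hB.diff hB₁, ?_⟩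
    rw [← clopenInd_add_diff hA hA₁ hAs, ← clopenInd_add_diff hB hB₁ hBs, hψadd, h₁] at h
    exact dimClass_add_left_cancel (h.trans (map_add (dimClass T) _ _))
  have hemptyX : ∀ (B : Set X) (hB : IsClopen B), dimClass T (clopenInd B hB) = 0 → B = ∅ := by
    intro B hB h0
    by_contra hne
    obtain ⟨x, hx⟩ := Set.nonempty_iff_ne_empty.2 hne
    have h1 := hT.intMean_pos hμ₀ (clopenInd_nonneg hB) fun h => by
      have := clopenInd_of_mem hB hx
      rw [h] at this
      exact zero_ne_one this
    exact h1.ne' (dimClass_eq_zero_iff.1 h0 μ₀ hμ₀)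
  have hemptyY : ∀ (A : Set Y) (hA : IsClopen A), ψ (clopenInd A hA) = 0 → A = ∅ := by
    intro A hA h0
    by_contra hne
    exact hψne A hA (Set.nonempty_iff_ne_empty.2 hne) h0
  obtain ⟨F, hF⟩ := exists_homeomorph_of_back_and_forth P ⟨isClopen_univ, isClopen_univ, by
      have h1 : clopenInd (Set.univ : Set Y) isClopen_univ = 1 :=
        ContinuousMap.ext fun y => clopenInd_of_mem _ trivial
      have h2 : clopenInd (Set.univ : Set X) isClopen_univ = 1 :=
        ContinuousMap.ext fun y => clopenInd_of_mem _ trivial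
      rw [h1, h2, hψone]⟩ (by
    rintro A B ⟨hA, hB, h⟩
    constructor
    · rintro rfl
      refine hemptyX B hB ?_
      rw [← h, hind0', hψzero]
    · rintro rfl
      refine hemptyY A hA ?_
      rw [h, hind0]
      exact map_zero (dimClass T)) (by
    rintro A B A' B' ⟨hA, hB, h⟩ ⟨hA', hB', h'⟩ hAd hBd
    refine ⟨hA.union hA', hB.union hB', ?_⟩
    have h1 := clopenInd_add_diff (hA.union hA') hA Set.subset_union_left
    have h2 := clopenInd_add_diff (hB.union hB') hB Set.subset_union_left
    have e1 : (A ∪ A') \ A = A' := by rw [Set.union_sdiff_left]; exact hAd.sdiff_eq_right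
    have e2 : (B ∪ B') \ B = B' := by rw [Set.union_sdiff_left]; exact hBd.sdiff_eq_right
    simp only [e1] at h1
    simp only [e2] at h2
    rw [← h1, ← h2, hψadd, h, h']
    exact (map_add (dimClass T) _ _).symm) (by
    rintro A B ⟨hA, hB, h⟩ A₁ hA₁ hAs
    obtain ⟨k, hk, hkψ⟩ := hψpos _ (clopenInd_nonneg hA₁)
    obtain ⟨k', hk', hkψ'⟩ := hψpos _ (clopenInd_nonneg (hA.diff hA₁))
    have hsum : dimClass T (k + k') = dimClass T (clopenInd B hB) := by
      rw [← h, ← clopenInd_add_diff hA hA₁ hAs, hψadd, ← hkψ, ← hkψ']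
      exact map_add (dimClass T) _ _
    -- Comparison needs a strict inequality, so the full set is treated apart.
    by_cases hne : A₁ = A
    · subst hne
      exact ⟨B, hB, subset_rfl, ⟨hA, hB, h⟩, hdiff hA hB hA hB subset_rfl subset_rfl h h⟩
    have hne' : (A \ A₁).Nonempty :=
      Set.sdiff_nonempty.2 fun h => hne (Set.Subset.antisymm hAs h)
    have hk'0 : k' ≠ 0 := by
      rintro rfl
      exact hψne _ _ hne' (hkψ'.symm.trans (map_zero (dimClass T)))
    obtain ⟨c, hc0, hcB, hck⟩ := exists_le_intMean_eq T hk (clopenInd_nonneg hB) fun μ hμ => by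
      have := hμ.1
      rw [← dimClass_eq_iff.1 hsum μ hμ, intMean_add]
      linarith [hT.intMean_pos hμ hk' hk'0]
    obtain ⟨B₁, hB₁, hBs, rfl⟩ := exists_eq_clopenInd hB hc0 hcB
    have h1 : ψ (clopenInd A₁ hA₁) = dimClass T (clopenInd B₁ hB₁) := by
      rw [← hkψ]
      exact (dimClass_eq_iff.2 hck).symm
    exact ⟨B₁, hB₁, hBs, ⟨hA₁, hB₁, h1⟩, hdiff hA hB hA₁ hB₁ hAs hBs h h1⟩) (by
    rintro A B ⟨hA, hB, h⟩ B₁ hB₁ hBs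
    -- Exhaustiveness needs `0 < h < φ g`, so the empty and the full set are treated apart.
    by_cases hB₁0 : B₁ = ∅
    · subst hB₁0
      have h1 : ψ (clopenInd ∅ isClopen_empty) = dimClass T (clopenInd ∅ hB₁) := by
        rw [hind0, hind0', hψzero]
        exact (map_zero (dimClass T)).symm
      exact ⟨∅, isClopen_empty, Set.empty_subset _, ⟨isClopen_empty, hB₁, h1⟩,
        hdiff hA hB isClopen_empty hB₁ (Set.empty_subset _) hBs h h1⟩
    by_cases hne : B₁ = B
    · subst hne
      exact ⟨A, hA, subset_rfl, ⟨hA, hB, h⟩, hdiff hA hB hA hB subset_rfl subset_rfl h h⟩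
    have hmem : ∀ {D : Set X} (hD : IsClopen D), D.Nonempty → ∀ μ ∈ invariantMeasures T,
        0 < intMean μ (clopenInd D hD) := fun hD hDne μ hμ => by
      obtain ⟨x, hx⟩ := hDne
      refine hT.intMean_pos hμ (clopenInd_nonneg hD) fun h => ?_
      have := clopenInd_of_mem hD hx
      rw [h] at this
      exact zero_ne_one this
    have hlt : coneLT (posCone T) (dimClass T (clopenInd B₁ hB₁)) (φ (dimClass S (clopenInd A hA))) := by
      change coneLT (posCone T) _ (ψ _)
      rw [h, coneLT_dimClass_iff hT]
      intro μ hμ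
      have := hμ.1
      rw [← clopenInd_add_diff hB hB₁ hBs, intMean_add]
      have := hmem (hB.diff hB₁) (Set.sdiff_nonempty.2 fun h =>
        hne (Set.Subset.antisymm hBs h)) μ hμ
      linarith
    -- The class of `B₁` lifts to a class below that of `A`; comparison for `S` then realises the
    -- lift by a clopen subset of `A`.
    obtain ⟨g, hgφ, hg0, hglt⟩ := hφ.exhaustive _ ⟨_, clopenInd_nonneg hA, rfl⟩
      (dimClass T (clopenInd B₁ hB₁))
      ((coneLT_zero_dimClass_iff hT).2 (hmem hB₁ (Set.nonempty_iff_ne_empty.2 hB₁0))) hlt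
    obtain ⟨⟨k, hk, hkg⟩, -⟩ := hg0
    rw [sub_zero] at hkg
    subst hkg
    rw [coneLT_dimClass_iff hS] at hglt
    obtain ⟨c, hc0, hcA, hck⟩ := exists_le_intMean_eq S hk (clopenInd_nonneg hA) hglt
    obtain ⟨A₁, hA₁, hAs, rfl⟩ := exists_eq_clopenInd hA hc0 hcA
    have h1 : ψ (clopenInd A₁ hA₁) = dimClass T (clopenInd B₁ hB₁) := by
      rw [← hgφ]
      exact congrArg φ (dimClass_eq_iff.2 hck)
    exact ⟨A₁, hA₁, hAs, ⟨hA₁, hB₁, h1⟩, hdiff hA hB hA₁ hB₁ hAs hBs h h1⟩)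
  refine ⟨F, fun μ hμ => mem_invariantMeasures_iff.2 ?_⟩
  have := hμ.1
  have hprob : IsProbabilityMeasure (μ.map F) :=
    Measure.isProbabilityMeasure_map F.continuous.aemeasurable
  have hprob' : IsProbabilityMeasure ((μ.map F).map S) :=
    Measure.isProbabilityMeasure_map S.continuous.aemeasurable
  refine ⟨hprob, S.continuous.measurable, ?_⟩
  refine ext_of_generate_finite {s : Set Y | IsClopen s} IsCantorSpace.borel_eq_generateFrom
    (fun s hs t ht _ => IsClopen.inter hs ht) (fun A hA => ?_) (by simp)
  have hA : IsClopen A := hA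
  have hSA : IsClopen (S ⁻¹' A) := hA.preimage S.continuous
  rw [Measure.map_apply S.continuous.measurable hA.isOpen.measurableSet,
    Measure.map_apply F.continuous.measurable hSA.isOpen.measurableSet,
    Measure.map_apply F.continuous.measurable hA.isOpen.measurableSet]
  obtain ⟨h1, h2, h3⟩ := hF A hA
  obtain ⟨h1', h2', h3'⟩ := hF _ hSA
  have heq : ψ (clopenInd (S ⁻¹' A) h1') = ψ (clopenInd A h1) :=
    hψS S (clopenInd A h1) PreservesInvariant.self
  rw [h3, h3'] at heq
  have := dimClass_eq_iff.1 heq μ hμ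
  rw [intMean_clopenInd, intMean_clopenInd] at this
  exact (measureReal_eq_measureReal_iff).1 this

end ExhaustiveToHomeomorph

/-! ### Matching clopen sets by positive powers -/

section PositiveMatching

variable {X : Type*} [TopologicalSpace X]

/-- A bijection from `A` to `B` given by positive powers of `T` with continuous exponent. -/
def PositivelyMatched (T : X ≃ₜ X) (A B : Set X) : Prop :=
  ∃ p : X → ℕ, Continuous p ∧ Set.BijOn (fun x => (T ^ (p x + 1)) x) A B

theorem Finset.exists_unique_of_sum_eq_one {s : Finset ℕ} {f : ℕ → ℤ} (hf : ∀ i, 0 ≤ f i)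
    (h : ∑ i ∈ s, f i = 1) : ∃ i ∈ s, f i = 1 ∧ ∀ j ∈ s, f j ≠ 0 → j = i := by
  obtain ⟨i, hi, hi0⟩ : ∃ i ∈ s, f i ≠ 0 := Finset.exists_ne_zero_of_sum_ne_zero (by omega)
  have h1 := Finset.add_sum_erase s f hi
  have h2 : 0 ≤ ∑ j ∈ s.erase i, f j := Finset.sum_nonneg fun j _ => hf j
  have h3 := hf i
  have h4 : ∑ j ∈ s.erase i, f j = 0 := by omega
  refine ⟨i, hi, by omega, fun j hj hj0 => ?_⟩
  by_contra hne
  exact hj0 ((Finset.sum_eq_zero_iff_of_nonneg fun j _ => hf j).1 h4 j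
    (Finset.mem_erase.2 ⟨hne, hj⟩))

/-- The weights `m i` sum to an indicator, so at each point of `A` exactly one is nonzero and names
the power to use. The same uniqueness at the points of `B` gives injectivity. -/
theorem positivelyMatched_of_transport {T : X ≃ₜ X} {A B : Set X} (hA : IsClopen A)
    (hB : IsClopen B) {N : ℕ} {m : ℕ → C(X, ℤ)} (hm : ∀ i x, 0 ≤ m i x)
    (hmA : ∑ i ∈ Finset.range N, m i = clopenInd A hA)
    (hmB : ∑ i ∈ Finset.range N, pullback (T ^ (i + 1)).symm (m i) = clopenInd B hB) :
    PositivelyMatched T A B := by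
  have hmA' : ∀ x, ∑ i ∈ Finset.range N, m i x = clopenInd A hA x := fun x => by
    rw [← hmA, ContinuousMap.sum_apply]
  have hmB' : ∀ x, ∑ i ∈ Finset.range N, m i ((T ^ (i + 1)).symm x) = clopenInd B hB x :=
    fun x => by
      rw [← hmB, ContinuousMap.sum_apply]; rfl
  -- On `A` a single weight equals one and the others vanish, so the sum returns the index of that
  -- weight.
  let p : X → ℕ := fun x => ∑ i ∈ Finset.range N, i * (m i x).toNat
  have hp : Continuous p := continuous_finsetSum _ fun i _ =>
    continuous_const.mul ((continuous_of_discreteTopology (f := Int.toNat)).comp (m i).continuous)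
  have hAuniq : ∀ x ∈ A, ∃ i ∈ Finset.range N, m i x = 1 ∧ ∀ j ∈ Finset.range N, m j x ≠ 0 → j = i :=
    fun x hx => Finset.exists_unique_of_sum_eq_one (fun i => hm i x)
      ((hmA' x).trans (clopenInd_of_mem hA hx))
  have hBuniq : ∀ y ∈ B, ∃ i ∈ Finset.range N, m i ((T ^ (i + 1)).symm y) = 1 ∧
      ∀ j ∈ Finset.range N, m j ((T ^ (j + 1)).symm y) ≠ 0 → j = i :=
    fun y hy => Finset.exists_unique_of_sum_eq_one (fun i => hm i _)
      ((hmB' y).trans (clopenInd_of_mem hB hy))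
  have hpeq : ∀ x ∈ A, p x ∈ Finset.range N ∧ m (p x) x = 1 ∧
      ∀ j ∈ Finset.range N, m j x ≠ 0 → j = p x := by
    intro x hx
    obtain ⟨i, hi, hi1, huniq⟩ := hAuniq x hx
    have : p x = i := by
      have h1 : p x = i * (m i x).toNat := Finset.sum_eq_single_of_mem i hi fun j hj hji => by
        have : m j x = 0 := by
          by_contra h
          exact hji (huniq j hj h)
        simp [this]
      rw [h1, hi1]; simp
    rw [this]
    exact ⟨hi, hi1, huniq⟩
  have hmaps : Set.MapsTo (fun x => (T ^ (p x + 1)) x) A B := by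
    intro x hx
    obtain ⟨hi, hi1, -⟩ := hpeq x hx
    rw [← clopenInd_pos_iff hB, ← hmB']
    refine Finset.sum_pos' (fun j _ => hm j _) ⟨p x, hi, ?_⟩
    simp [hi1]
  refine ⟨p, hp, hmaps, ?_, ?_⟩
  · intro x hx x' hx' h
    obtain ⟨hi, hi1, -⟩ := hpeq x hx
    obtain ⟨hi', hi1', -⟩ := hpeq x' hx'
    obtain ⟨j, hj, -, huniq⟩ := hBuniq _ (hmaps hx)
    have h1 := huniq (p x) hi (by simp [hi1])
    have h2 := huniq (p x') hi' (by simp only at h; simp [h, hi1'])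
    simp only at h
    rw [h1, h2] at h
    exact (T ^ (j + 1)).injective h
  · intro y hy
    obtain ⟨j, hj, hj1, -⟩ := hBuniq y hy
    have hx : (T ^ (j + 1)).symm y ∈ A := by
      rw [← clopenInd_pos_iff hA, ← hmA']
      exact Finset.sum_pos' (fun j _ => hm j _) ⟨j, hj, by rw [hj1]; exact one_pos⟩
    refine ⟨_, hx, ?_⟩
    obtain ⟨-, -, huniq⟩ := hpeq _ hx
    have := huniq j hj (by rw [hj1]; exact one_ne_zero)
    simp only
    rw [← this, Homeomorph.apply_symm_apply]

theorem PositivelyMatched.union {T : X ≃ₜ X} {A B A' B' : Set X} (h : PositivelyMatched T A B)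
    (h' : PositivelyMatched T A' B') (hA : IsClopen A) (hAA' : Disjoint A A')
    (hBB' : Disjoint B B') : PositivelyMatched T (A ∪ A') (B ∪ B') := by
  classical
  obtain ⟨p, hp, hpb⟩ := h
  obtain ⟨p', hp', hpb'⟩ := h'
  refine ⟨fun x => if x ∈ A then p x else p' x, hp.if (fun x hx => ?_) hp', ?_⟩
  · have hx : x ∈ frontier A := hx
    rw [hA.frontier_eq] at hx
    exact hx.elim
  have e1 : Set.EqOn (fun x => (T ^ (p x + 1)) x)
      (fun x => (T ^ ((if x ∈ A then p x else p' x) + 1)) x) A := fun x hx => by simp [hx]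
  have e2 : Set.EqOn (fun x => (T ^ (p' x + 1)) x)
      (fun x => (T ^ ((if x ∈ A then p x else p' x) + 1)) x) A' := fun x hx => by
    have : x ∉ A := fun h => hAA'.le_bot ⟨h, hx⟩
    simp [this]
  have b1 := hpb.congr e1
  have b2 := hpb'.congr e2
  refine b1.union b2 ?_
  rw [Set.injOn_union hAA']
  exact ⟨b1.injOn, b2.injOn, fun x hx y hy hxy =>
    hBB'.le_bot ⟨b1.mapsTo hx, hxy ▸ b2.mapsTo hy⟩⟩

/-! ### Matching under inequalities of measures -/

variable [IsCantorSpace X] [MeasurableSpace X] [BorelSpace X] {T : X ≃ₜ X}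

theorem exists_positivelyMatched_subset_right {A B : Set X} (hA : IsClopen A) (hB : IsClopen B)
    (h : ∀ μ ∈ invariantMeasures T, μ.real A < μ.real B) :
    ∃ D, IsClopen D ∧ D ⊆ B ∧ PositivelyMatched T A D ∧
      ∀ μ ∈ invariantMeasures T, μ.real D = μ.real A := by
  obtain ⟨N, m, hm, hmA, hmB⟩ := exists_positive_transport T (clopenInd_nonneg hA)
    (clopenInd_nonneg hB) fun μ hμ => by simpa only [intMean_clopenInd] using h μ hμ
  obtain ⟨D, hD, hDB, hmD⟩ := exists_eq_clopenInd hB (fun x => by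
    rw [ContinuousMap.sum_apply]
    exact Finset.sum_nonneg fun i _ => hm i _) hmB
  refine ⟨D, hD, hDB, positivelyMatched_of_transport hA hD hm hmA hmD, fun μ hμ => ?_⟩
  have := hμ.1
  rw [← intMean_clopenInd μ hD, ← intMean_clopenInd μ hA, ← hmA, ← hmD, intMean_sum, intMean_sum]
  exact Finset.sum_congr rfl fun i _ => intMean_comp ((PreservesInvariant.self.pow _).symm μ hμ) _

/-- Transport `B` into `A` by positive powers of `T⁻¹` and read the matching backwards. -/
theorem exists_positivelyMatched_subset_left {A B : Set X} (hA : IsClopen A) (hB : IsClopen B)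
    (h : ∀ μ ∈ invariantMeasures T, μ.real B < μ.real A) :
    ∃ D, IsClopen D ∧ D ⊆ A ∧ PositivelyMatched T D B ∧
      ∀ μ ∈ invariantMeasures T, μ.real D = μ.real B := by
  obtain ⟨N, m, hm, hmB, hmA⟩ := exists_positive_transport T⁻¹ (clopenInd_nonneg hB)
    (clopenInd_nonneg hA) fun μ hμ => by
      rw [invariantMeasures_inv] at hμ
      simpa only [intMean_clopenInd] using h μ hμ
  obtain ⟨D, hD, hDA, hmD⟩ := exists_eq_clopenInd hA (fun x => by
    rw [ContinuousMap.sum_apply]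
    exact Finset.sum_nonneg fun i _ => hm i _) hmA
  have hpow : ∀ i : ℕ, ((T⁻¹ ^ (i + 1) : X ≃ₜ X)).symm = T ^ (i + 1) := fun i => by
    rw [inv_pow]; rfl
  simp only [hpow] at hmD
  refine ⟨D, hD, hDA, positivelyMatched_of_transport hD hB (N := N)
    (m := fun i => pullback (T ^ (i + 1)) (m i)) (fun i x => hm i _) hmD ?_, fun μ hμ => ?_⟩
  · rw [← hmB]
    refine Finset.sum_congr rfl fun i _ => ContinuousMap.ext fun x => ?_
    simp
  · have := hμ.1
    rw [← intMean_clopenInd μ hD, ← intMean_clopenInd μ hB, ← hmB, ← hmD, intMean_sum, intMean_sum]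
    exact Finset.sum_congr rfl fun i _ => intMean_comp (PreservesInvariant.self.pow _ μ hμ) _

theorem IsMinimalHomeo.measureReal_pos (hT : IsMinimalHomeo T) {A : Set X} (hA : IsClopen A)
    (hne : A.Nonempty) {μ : Measure X} (hμ : μ ∈ invariantMeasures T) : 0 < μ.real A := by
  have := hμ.1
  exact ENNReal.toReal_pos (hT.measure_pos hμ hA.isOpen hne).ne' (measure_ne_top _ _)

theorem IsMinimalHomeo.exists_hitting_bound (hT : IsMinimalHomeo T) {A : Set X} (hA : IsClopen A)
    (hne : A.Nonempty) : ∃ n : ℕ, ∀ x, ∃ i < n, (T ^ i) x ∈ A := by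
  obtain ⟨n, hn⟩ := exists_forall_orbit_sum_pos T (clopenInd A hA) fun μ hμ => by
    rw [intMean_clopenInd]
    exact hT.measureReal_pos hA hne hμ
  refine ⟨n, fun x => ?_⟩
  obtain ⟨i, hi, hi0⟩ := Finset.exists_ne_zero_of_sum_ne_zero (hn x).ne'
  refine ⟨i, Finset.mem_range.1 hi, ?_⟩
  rw [← clopenInd_pos_iff hA]
  exact lt_of_le_of_ne (clopenInd_nonneg hA _) hi0.symm

/-- Small clopen neighbourhoods have uniformly small measure. -/
theorem IsMinimalHomeo.exists_small_nhd (hT : IsMinimalHomeo T) {A : Set X} (hA : IsClopen A)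
    (hne : A.Nonempty) {b : X} {V : Set X} (hV : IsClopen V) (hb : b ∈ V) :
    ∃ B, IsClopen B ∧ b ∈ B ∧ B ⊆ V ∧ ∀ μ ∈ invariantMeasures T, μ.real B < μ.real A := by
  obtain ⟨n, hn⟩ := exists_forall_orbit_sum_pos T (clopenInd A hA) fun μ hμ => by
    rw [intMean_clopenInd]
    exact hT.measureReal_pos hA hne hμ
  -- The set `B` below avoids its first `n` translates, so `n + 1` translates are disjoint and `(n +
  -- 1) * μ B ≤ 1`. The `n` translates of `A` cover the space, so `1 ≤ n * μ A`.
  have hsep : ∀ i : ℕ, ∃ C, IsClopen C ∧ b ∈ C ∧ ∀ x ∈ C, (T ^ (i + 1)) x ∉ C := by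
    intro i
    obtain ⟨D, hD, hbD, hTb⟩ := IsCantorSpace.exists_isClopen_mem_notMem
      (hT.pow_apply_ne (Nat.succ_pos i) b).symm
    exact ⟨D \ (T ^ (i + 1)) ⁻¹' D, hD.diff (hD.preimage (T ^ (i + 1)).continuous), ⟨hbD, hTb⟩,
      fun x hx hx' => hx.2 hx'.1⟩
  choose C hC hbC hCd using hsep
  refine ⟨V ∩ ⋂ i ∈ Finset.range n, C i, hV.inter (isClopen_biInter_finset fun i _ => hC i),
    ⟨hb, by simpa using fun i _ => hbC i⟩, Set.inter_subset_left, fun μ hμ => ?_⟩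
  set B := V ∩ ⋂ i ∈ Finset.range n, C i with hBdef
  have hB : IsClopen B := hV.inter (isClopen_biInter_finset fun i _ => hC i)
  have := hμ.1
  have hBC : ∀ i < n, ∀ x ∈ B, (T ^ (i + 1)) x ∉ B := by
    intro i hi x hx hx'
    have h1 : ∀ y ∈ B, y ∈ C i := fun y hy => by
      have := hy.2
      simp only [Set.mem_iInter, Finset.mem_range] at this
      exact this i hi
    exact hCd i x (h1 x hx) (h1 _ hx')
  have hmeas : ∀ i : ℕ, μ.real ((T ^ i) ⁻¹' B) = μ.real B := fun i => by
    rw [measureReal_def, (PreservesInvariant.self.pow i μ hμ).measure_preimage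
      hB.isOpen.measurableSet.nullMeasurableSet, measureReal_def]
  have hdisj : Set.PairwiseDisjoint (↑(Finset.range (n + 1))) fun i : ℕ => (T ^ i) ⁻¹' B := by
    have key : ∀ i j : ℕ, i < j → j < n + 1 → Disjoint ((T ^ i) ⁻¹' B) ((T ^ j) ⁻¹' B) := by
      intro i j hij hj
      rw [Set.disjoint_left]
      intro x hx hx'
      refine hBC (j - i - 1) (by omega) _ hx ?_
      rw [Homeomorph.pow_apply_pow_apply]
      have : j - i - 1 + 1 + i = j := by omega
      rw [this]
      exact hx'
    intro i hi j hj hij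
    simp only [Finset.coe_range, Set.mem_Iio] at hi hj
    rcases lt_or_gt_of_ne hij with h | h
    · exact key i j h hj
    · exact (key j i h hi).symm
  have h1 : ((n : ℝ) + 1) * μ.real B ≤ 1 := by
    have h2 := measureReal_biUnion_finset (μ := μ) hdisj fun i _ =>
      (hB.preimage (T ^ i).continuous).isOpen.measurableSet
    simp only [hmeas, Finset.sum_const, Finset.card_range, nsmul_eq_mul] at h2
    push_cast at h2
    rw [← h2]
    exact measureReal_le_one
  have h3 : 1 ≤ (n : ℝ) * μ.real A := by
    have h4 : intMean μ 1 ≤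
        intMean μ (∑ i ∈ Finset.range n, pullback (T ^ i) (clopenInd A hA)) :=
      intMean_mono μ fun x => by
        have := hn x
        simp only [ContinuousMap.sum_apply, pullback_apply, ContinuousMap.one_apply]
        omega
    rw [intMean_one, intMean_sum] at h4
    have h5 : ∀ i ∈ Finset.range n, intMean μ (pullback (T ^ i) (clopenInd A hA)) = μ.real A :=
      fun i _ => by
        rw [pullback, intMean_comp (PreservesInvariant.self.pow i μ hμ), intMean_clopenInd]
    rw [Finset.sum_congr rfl h5] at h4
    simpa using h4
  have h6 := hT.measureReal_pos hB ⟨b, hb, by simpa using fun i _ => hbC i⟩ hμ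
  by_contra h
  push Not at h
  have : (n : ℝ) * μ.real A ≤ n * μ.real B := mul_le_mul_of_nonneg_left h (Nat.cast_nonneg n)
  nlinarith

theorem measureReal_clopen_sdiff {μ : Measure X} [IsFiniteMeasure μ] {A B : Set X} (hB : IsClopen B)
    (h : B ⊆ A) : μ.real (A \ B) = μ.real A - μ.real B :=
  measureReal_sdiff h hB.isOpen.measurableSet

/-- Match all of `A` and `B` except for small neighbourhoods of given points. -/
theorem IsMinimalHomeo.exists_matching_off_nhds (hT : IsMinimalHomeo T) {A B U V : Set X}
    (hA : IsClopen A) (hB : IsClopen B) (hAB : ∀ μ ∈ invariantMeasures T, μ.real A = μ.real B)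
    (hU : IsClopen U) (hV : IsClopen V) {a b : X} (ha : a ∈ A) (hb : b ∈ B) (haU : a ∈ U)
    (hbV : b ∈ V) :
    ∃ A₁ B₁, IsClopen A₁ ∧ IsClopen B₁ ∧ a ∈ A₁ ∧ b ∈ B₁ ∧ A₁ ⊆ A ∩ U ∧ B₁ ⊆ B ∩ V ∧
      (∀ μ ∈ invariantMeasures T, μ.real A₁ = μ.real B₁) ∧
      PositivelyMatched T (A \ A₁) (B \ B₁) := by
  have hA' : IsClopen (A ∩ U) := hA.inter hU
  -- First half: as `B'` is smaller than `A ∩ U`, the rest of `A` is smaller than `B \ B'` and is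
  -- matched with a part `D` of it.
  obtain ⟨B', hB', hbB', hB's, hB'lt⟩ := hT.exists_small_nhd hA' ⟨a, ha, haU⟩ (hB.inter hV)
    (b := b) ⟨hb, hbV⟩
  have hB'B : B' ⊆ B := hB's.trans Set.inter_subset_left
  obtain ⟨D, hD, hDs, hDm, hDμ⟩ := exists_positivelyMatched_subset_right (T := T)
    (hA.diff hA') (hB.diff hB') fun μ hμ => by
      have := hμ.1
      rw [measureReal_clopen_sdiff hA' Set.inter_subset_left, measureReal_clopen_sdiff hB' hB'B, hAB μ hμ]
      linarith [hB'lt μ hμ]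
  -- Second half: as `A''` is smaller than `B'`, the rest of `B` off `B'` is smaller than `(A ∩ U) \
  -- A''` and is matched from a part `E` of it. Only `B'` and `(A ∩ U) \ E` remain.
  obtain ⟨A'', hA'', haA'', hA''s, hA''lt⟩ := hT.exists_small_nhd hB' ⟨b, hbB'⟩ hA'
    (b := a) ⟨ha, haU⟩
  have hDB : D ⊆ B := fun x hx => (hDs hx).1
  have hB'D : B' ⊆ B \ D := fun x hx => ⟨hB'B hx, fun h => (hDs h).2 hx⟩
  obtain ⟨E, hE, hEs, hEm, hEμ⟩ := exists_positivelyMatched_subset_left (T := T)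
    (hA'.diff hA'') ((hB.diff hD).diff hB') fun μ hμ => by
      have := hμ.1
      rw [measureReal_clopen_sdiff hB' hB'D, measureReal_clopen_sdiff hD hDB, hDμ μ hμ,
        measureReal_clopen_sdiff hA' Set.inter_subset_left, measureReal_clopen_sdiff hA'' hA''s, hAB μ hμ]
      linarith [hA''lt μ hμ]
  have hEA' : E ⊆ A ∩ U := fun x hx => (hEs hx).1
  refine ⟨(A ∩ U) \ E, B', hA'.diff hE, hB', ⟨⟨ha, haU⟩, fun h => (hEs h).2 haA''⟩, hbB',
    Set.sdiff_subset, hB's, fun μ hμ => ?_, ?_⟩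
  · have := hμ.1
    rw [measureReal_clopen_sdiff hE hEA', hEμ μ hμ, measureReal_clopen_sdiff hB' hB'D, measureReal_clopen_sdiff hD hDB,
      hDμ μ hμ, measureReal_clopen_sdiff hA' Set.inter_subset_left, hAB μ hμ]
    ring
  · have h1 := hDm.union hEm (hA.diff hA')
      (Set.disjoint_left.2 fun x hx hx' => hx.2 (hEA' hx'))
      (Set.disjoint_left.2 fun x hx hx' => hx'.1.2 hx)
    convert h1 using 1
    · ext x
      constructor
      · rintro ⟨hx, hx'⟩
        by_cases hxU : x ∈ A ∩ U
        · right
          by_contra h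
          exact hx' ⟨hxU, h⟩
        · exact Or.inl ⟨hx, hxU⟩
      · rintro (⟨hx, hxU⟩ | hx)
        · exact ⟨hx, fun h => hxU h.1⟩
        · exact ⟨(hEA' hx).1, fun h => h.2 hx⟩
    · ext x
      constructor
      · rintro ⟨hx, hx'⟩
        by_cases hxD : x ∈ D
        · exact Or.inl hxD
        · exact Or.inr ⟨⟨hx, hxD⟩, hx'⟩
      · rintro (hx | ⟨⟨hx, -⟩, hx'⟩)
        · exact hDs hx
        · exact ⟨hx, hx'⟩

end PositiveMatching

/-! ### Matching sets of equal measures, off one point -/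

section PointedMatching

variable {X : Type*} [TopologicalSpace X] [IsCantorSpace X] [MeasurableSpace X] [BorelSpace X]
  {T : X ≃ₜ X}

/-- A pair of clopen sets of equal invariant measures around two given points. -/
structure PointedPair (T : X ≃ₜ X) (a b : X) where
  left : Set X
  right : Set X
  isClopen_left : IsClopen left
  isClopen_right : IsClopen right
  mem_left : a ∈ left
  mem_right : b ∈ right
  measure_eq : ∀ μ ∈ invariantMeasures T, μ.real left = μ.real right

/-- Clopen sets of equal invariant measures are matched by positive powers of `T`, off one point
whose image can be prescribed. -/
theorem IsMinimalHomeo.exists_pointed_matching (hT : IsMinimalHomeo T) {A B : Set X}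
    (hA : IsClopen A) (hB : IsClopen B) (hAB : ∀ μ ∈ invariantMeasures T, μ.real A = μ.real B)
    {a b : X} (ha : a ∈ A) (hb : b ∈ B) :
    ∃ θ : X → X, ContinuousOn θ A ∧ Set.MapsTo θ A B ∧ Set.InjOn θ A ∧ θ a = b ∧
      ∀ x ∈ A, x ≠ a → ∃ n : ℕ, θ x = (T ^ (n + 1)) x := by
  classical
  obtain ⟨U, -, hU, haU, hUbasis⟩ := IsCantorSpace.exists_antitone_isClopen_basis a
  obtain ⟨V, -, hV, hbV, hVbasis⟩ := IsCantorSpace.exists_antitone_isClopen_basis b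
  have hstep : ∀ (n : ℕ) (q : PointedPair T a b), ∃ q' : PointedPair T a b,
      q'.left ⊆ q.left ∩ U n ∧ q'.right ⊆ q.right ∩ V n ∧
      PositivelyMatched T (q.left \ q'.left) (q.right \ q'.right) := by
    intro n q
    obtain ⟨A₁, B₁, h1, h2, h3, h4, h5, h6, h7, h8⟩ := hT.exists_matching_off_nhds q.isClopen_left
      q.isClopen_right q.measure_eq (hU n) (hV n) q.mem_left q.mem_right (haU n) (hbV n)
    exact ⟨⟨A₁, B₁, h1, h2, h3, h4, h7⟩, h5, h6, h8⟩
  choose next hnl hnr hnm using hstep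
  let q : ℕ → PointedPair T a b := fun n =>
    Nat.rec ⟨A, B, hA, hB, ha, hb, hAB⟩ (fun n q => next n q) n
  have hq0l : (q 0).left = A := rfl
  have hq0r : (q 0).right = B := rfl
  have hantil : Antitone fun n => (q n).left :=
    antitone_nat_of_succ_le fun n => (hnl n (q n)).trans Set.inter_subset_left
  have hantir : Antitone fun n => (q n).right :=
    antitone_nat_of_succ_le fun n => (hnr n (q n)).trans Set.inter_subset_left
  have hm : ∀ n, PositivelyMatched T ((q n).left \ (q (n + 1)).left)
      ((q n).right \ (q (n + 1)).right) := fun n => hnm n (q n)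
  choose p hp hpb using hm
  have hexit : ∀ x ∈ A, x ≠ a → ∃ n, x ∈ (q n).left \ (q (n + 1)).left := by
    intro x hx hxa
    obtain ⟨n, hn⟩ := hUbasis {x}ᶜ isOpen_compl_singleton (by simpa using hxa.symm)
    have hex : ∃ n, x ∉ (q n).left := ⟨n + 1, fun h => hn (hnl n (q n) h).2 rfl⟩
    have hpos : Nat.find hex ≠ 0 := fun h => by
      have := Nat.find_spec hex
      rw [h] at this
      exact this hx
    obtain ⟨k, hk⟩ := Nat.exists_eq_succ_of_ne_zero hpos
    refine ⟨k, not_not.1 (Nat.find_min hex (m := k) (by omega)), ?_⟩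
    have := Nat.find_spec hex
    rwa [hk] at this
  have huniq : ∀ (Z : ℕ → Set X), Antitone Z → ∀ x m n, x ∈ Z m \ Z (m + 1) →
      x ∈ Z n \ Z (n + 1) → m = n := by
    intro Z hZ x m n hxm hxn
    rcases lt_trichotomy m n with h | h | h
    · exact absurd (hZ h hxn.1) hxm.2
    · exact h
    · exact absurd (hZ h hxm.1) hxn.2
  -- The only point of `A` in no layer is `a`, and the default value `b` is its prescribed image.
  let θ : X → X := fun x => if h : ∃ n, x ∈ (q n).left \ (q (n + 1)).left then
    (T ^ (p h.choose x + 1)) x else b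
  have hθ : ∀ n, ∀ x ∈ (q n).left \ (q (n + 1)).left, θ x = (T ^ (p n x + 1)) x := by
    intro n x hx
    have h : ∃ n, x ∈ (q n).left \ (q (n + 1)).left := ⟨n, hx⟩
    have hn : h.choose = n := huniq _ hantil x _ _ h.choose_spec hx
    simp only [θ, dif_pos h, hn]
  have hθa : θ a = b := dif_neg fun ⟨n, hn⟩ => hn.2 (q (n + 1)).mem_left
  have hθmem : ∀ n, ∀ x ∈ (q n).left \ (q (n + 1)).left, θ x ∈ (q n).right \ (q (n + 1)).right := by
    intro n x hx
    rw [hθ n x hx]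
    exact (hpb n).mapsTo hx
  have hcases : ∀ n, ∀ x ∈ (q n).left, x = a ∨ ∃ m ≥ n, x ∈ (q m).left \ (q (m + 1)).left := by
    intro n x hx
    by_cases hxa : x = a
    · exact Or.inl hxa
    · obtain ⟨m, hm⟩ := hexit x (hantil (Nat.zero_le n) hx) hxa
      refine Or.inr ⟨m, ?_, hm⟩
      by_contra h
      exact hm.2 (hantil (show m + 1 ≤ n by omega) hx)
  have hθmaps : ∀ n, Set.MapsTo θ (q n).left (q n).right := by
    intro n x hx
    rcases hcases n x hx with rfl | ⟨m, hmn, hm⟩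
    · rw [hθa]; exact (q n).mem_right
    · exact hantir hmn (hθmem m x hm).1
  refine ⟨θ, ?_, hθmaps 0, ?_, hθa, fun x hx hxa => ?_⟩
  · intro x hx
    refine ContinuousAt.continuousWithinAt ?_
    rcases hcases 0 x hx with rfl | ⟨n, -, hn⟩
    -- Near `a`, the neighbourhood `(q (n + 1)).left` is mapped into `(q (n + 1)).right`, which lies
    -- in `V n`.
    · rw [ContinuousAt, hθa]
      intro W hW
      obtain ⟨W', hW', hWo, hbW⟩ := mem_nhds_iff.1 hW
      obtain ⟨n, hn⟩ := hVbasis W' hWo hbW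
      refine Filter.mem_map.2 (Filter.mem_of_superset
        ((q (n + 1)).isClopen_left.isOpen.mem_nhds (q (n + 1)).mem_left) fun y hy => ?_)
      exact hW' (hn ((hnr n (q n)) (hθmaps (n + 1) hy)).2)
    · have hopen : IsOpen ((q n).left \ (q (n + 1)).left) :=
        ((q n).isClopen_left.diff (q (n + 1)).isClopen_left).isOpen
      have hnhds := hopen.mem_nhds hn
      have hconst : ∀ᶠ y in 𝓝 x, θ y = (T ^ (p n x + 1)) y := by
        have h1 : (p n) ⁻¹' {p n x} ∈ 𝓝 x :=
          ((isOpen_discrete {p n x}).preimage (hp n)).mem_nhds rfl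
        filter_upwards [hnhds, h1] with y hy hy'
        have hy' : p n y = p n x := hy'
        rw [hθ n y hy, hy']
      exact ((T ^ (p n x + 1)).continuous.continuousAt).congr
        (hconst.mono fun y hy => hy.symm)
  · intro x hx y hy hxy
    rcases hcases 0 x hx with rfl | ⟨m, -, hm⟩
    · rcases hcases 0 y hy with rfl | ⟨n, -, hn⟩
      · rfl
      · have := (hθmem n y hn).2
        rw [← hxy, hθa] at this
        exact absurd (q (n + 1)).mem_right this
    · rcases hcases 0 y hy with rfl | ⟨n, -, hn⟩
      · have := (hθmem m x hm).2
        rw [hxy, hθa] at this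
        exact absurd (q (m + 1)).mem_right this
      · have h1 := hθmem m x hm
        have h2 := hθmem n y hn
        rw [← hxy] at h2
        obtain rfl := huniq _ hantir _ _ _ h1 h2
        refine (hpb m).injOn hm hn ?_
        rw [← hθ m x hm, ← hθ m y hn, hxy]
  · obtain ⟨n, hn⟩ := hexit x hx hxa
    exact ⟨_, hθ n x hn⟩

/-- Prescribing for the exceptional point an image on its own strict forward orbit makes the
exponent positive there too. -/
theorem IsMinimalHomeo.exists_matching (hT : IsMinimalHomeo T) {A B : Set X}
    (hA : IsClopen A) (hB : IsClopen B) (hAB : ∀ μ ∈ invariantMeasures T, μ.real A = μ.real B) :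
    ∃ θ : X → X, ContinuousOn θ A ∧ Set.MapsTo θ A B ∧ Set.InjOn θ A ∧
      ∀ x ∈ A, ∃ n : ℕ, θ x = (T ^ (n + 1)) x := by
  rcases A.eq_empty_or_nonempty with rfl | ⟨a, ha⟩
  · exact ⟨id, continuousOn_empty _, Set.mapsTo_empty _ _, Set.injOn_empty _,
      fun x hx => hx.elim⟩
  · have hBne : B.Nonempty := by
      by_contra hne
      rw [Set.not_nonempty_iff_eq_empty] at hne
      obtain ⟨μ, hμ⟩ := invariantMeasures_nonempty T
      have h1 := hT.measureReal_pos hA ⟨a, ha⟩ hμ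
      rw [hAB μ hμ, hne, measureReal_empty] at h1
      exact lt_irrefl _ h1
    obtain ⟨n, hn⟩ := hT.exists_hitting_bound hB hBne
    obtain ⟨i, -, hi⟩ := hn (T a)
    have hi' : (T ^ (i + 1)) a ∈ B := by rwa [pow_succ, Homeomorph.mul_apply]
    obtain ⟨θ, h1, h2, h3, h4, h5⟩ := hT.exists_pointed_matching hA hB hAB ha hi'
    refine ⟨θ, h1, h2, h3, fun x hx => ?_⟩
    by_cases hxa : x = a
    · subst hxa
      exact ⟨i, h4⟩
    · exact h5 x hx hxa

/-- The homeomorphisms preserving the invariant measures act transitively on clopen sets. -/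
theorem IsMinimalHomeo.exists_preserving_moving (hT : IsMinimalHomeo T) {W : Set X}
    (hW : IsClopen W) {a b : X} (ha : a ∈ W) (hb : b ∈ W) :
    ∃ e : X ≃ₜ X, PreservesInvariant T e ∧ e a = b ∧ (∀ x ∉ W, e x = x) ∧ ∀ x ∈ W, e x ∈ W := by
  classical
  obtain ⟨θ, hθc, hθm, hθi, hθa, hθT⟩ := hT.exists_pointed_matching hW hW (fun _ _ => rfl) ha hb
  let G : X → X := fun x => if x ∈ W then θ x else x
  have hGW : ∀ x ∈ W, G x = θ x := fun x hx => if_pos hx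
  have hGW' : ∀ x ∉ W, G x = x := fun x hx => if_neg hx
  have hGc : Continuous G := continuous_iff_continuousAt.2 fun x => by
    by_cases hx : x ∈ W
    · have hW' := hW.isOpen.mem_nhds hx
      exact (hθc.continuousAt hW').congr (Filter.mem_of_superset hW' fun y hy => (hGW y hy).symm)
    · have hW' := hW.compl.isOpen.mem_nhds hx
      exact continuousAt_id.congr (Filter.mem_of_superset hW' fun y hy => (hGW' y hy).symm)
  have hGi : Function.Injective G := by
    intro x y hxy
    by_cases hx : x ∈ W
    · by_cases hy : y ∈ W
      · rw [hGW x hx, hGW y hy] at hxy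
        exact hθi hx hy hxy
      · rw [hGW x hx, hGW' y hy] at hxy
        exact absurd (hxy ▸ hθm hx) hy
    · by_cases hy : y ∈ W
      · rw [hGW' x hx, hGW y hy] at hxy
        exact absurd (hxy ▸ hθm hy) hx
      · rwa [hGW' x hx, hGW' y hy] at hxy
  obtain ⟨e, heG, he⟩ := exists_homeomorph_of_piecewise hT hGc hGi (fun n => T ^ n)
    (fun n => PreservesInvariant.self.pow n) {a} (fun μ hμ => hT.measure_singleton hμ a)
    fun x hx => by
      by_cases hxW : x ∈ W
      · obtain ⟨n, hn⟩ := hθT x hxW hx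
        exact ⟨n + 1, by rw [hGW x hxW, hn]⟩
      · exact ⟨0, by rw [hGW' x hxW]; rfl⟩
  refine ⟨e, he, ?_, fun x hx => ?_, fun x hx => ?_⟩
  · rw [heG, hGW a ha, hθa]
  · rw [heG, hGW' x hx]
  · rw [heG, hGW x hx]
    exact hθm hx

/-- Replace a homeomorphism on a clopen set by positive powers of `T`, keeping track of the
labels of the images. -/
theorem IsMinimalHomeo.exists_positive_on (hT : IsMinimalHomeo T) {κ : Type*} {R : X ≃ₜ X}
    (hR : PreservesInvariant T R) {D : Set X} (hD : IsClopen D) {lab : X → κ}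
    (hlab : IsLocallyConstant lab) :
    ∃ G : X ≃ₜ X, PreservesInvariant T G ∧ (∀ x ∉ D, G x = R x) ∧
      (∀ x, lab (G x) = lab (R x)) ∧ ∀ x ∈ D, ∃ n : ℕ, G x = (T ^ (n + 1)) x := by
  classical
  -- Points of `D` are grouped by the label of their `R`-image, and each group is matched into its
  -- own `R`-image; hence labels of images are kept.
  have hA : ∀ k, IsClopen (D ∩ R ⁻¹' (lab ⁻¹' {k})) := fun k =>
    hD.inter ((hlab.isClopen_fiber k).preimage R.continuous)
  have hB : ∀ k, IsClopen (R '' (D ∩ R ⁻¹' (lab ⁻¹' {k}))) := fun k =>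
    ⟨R.isClosedMap _ (hA k).isClosed, R.isOpenMap _ (hA k).isOpen⟩
  have hAB : ∀ k, ∀ μ ∈ invariantMeasures T, μ.real (D ∩ R ⁻¹' (lab ⁻¹' {k})) =
      μ.real (R '' (D ∩ R ⁻¹' (lab ⁻¹' {k}))) := fun k μ hμ => by
    rw [measureReal_def, measureReal_def,
      ← (hR μ hμ).measure_preimage (hB k).isOpen.measurableSet.nullMeasurableSet,
      Set.preimage_image_eq _ R.injective]
  choose θ hθc hθm hθi hθT using fun k => hT.exists_matching (hA k) (hB k) (hAB k)
  let G : X → X := fun x => if x ∈ D then θ (lab (R x)) x else R x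
  have hGD : ∀ x ∈ D, G x = θ (lab (R x)) x := fun x hx => if_pos hx
  have hGD' : ∀ x ∉ D, G x = R x := fun x hx => if_neg hx
  have himg : ∀ x ∈ D, ∃ z ∈ D, G x = R z ∧ lab (R z) = lab (R x) := fun x hx => by
    obtain ⟨z, ⟨hzD, hz⟩, hzx⟩ := hθm (lab (R x)) ⟨hx, rfl⟩
    exact ⟨z, hzD, by rw [hGD x hx, hzx], hz⟩
  have hGlab : ∀ x, lab (G x) = lab (R x) := fun x => by
    by_cases hx : x ∈ D
    · obtain ⟨z, -, hz, hz'⟩ := himg x hx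
      rw [hz, hz']
    · rw [hGD' x hx]
  have hGc : Continuous G := continuous_iff_continuousAt.2 fun x => by
    by_cases hx : x ∈ D
    · have hn := (hA (lab (R x))).isOpen.mem_nhds ⟨hx, rfl⟩
      refine ((hθc (lab (R x))).continuousAt hn).congr
        (Filter.mem_of_superset hn fun y hy => ?_)
      have hy2 : lab (R y) = lab (R x) := hy.2
      change θ (lab (R x)) y = G y
      rw [hGD y hy.1, hy2]
    · have hn := hD.compl.isOpen.mem_nhds hx
      exact R.continuous.continuousAt.congr
        (Filter.mem_of_superset hn fun y hy => (hGD' y hy).symm)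
  have hGi : Function.Injective G := by
    intro x y hxy
    have hl : lab (R x) = lab (R y) := by rw [← hGlab, ← hGlab, hxy]
    by_cases hx : x ∈ D
    · by_cases hy : y ∈ D
      · rw [hGD x hx, hGD y hy, hl] at hxy
        exact hθi (lab (R y)) ⟨hx, hl⟩ ⟨hy, rfl⟩ hxy
      · obtain ⟨z, hzD, hz, -⟩ := himg x hx
        rw [hz, hGD' y hy] at hxy
        exact absurd (R.injective hxy ▸ hzD) hy
    · by_cases hy : y ∈ D
      · obtain ⟨z, hzD, hz, -⟩ := himg y hy
        rw [hz, hGD' x hx] at hxy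
        exact absurd (R.injective hxy ▸ hzD) hx
      · rw [hGD' x hx, hGD' y hy] at hxy
        exact R.injective hxy
  obtain ⟨e, heG, he⟩ := exists_homeomorph_of_piecewise hT hGc hGi
    (fun n => if n = 0 then R else T ^ n) (fun n => by
      by_cases hn : n = 0
      · simpa [hn] using hR
      · simpa [hn] using PreservesInvariant.self.pow n) ∅ (fun μ _ => measure_empty)
    fun x _ => by
      by_cases hx : x ∈ D
      · obtain ⟨n, hn⟩ := hθT (lab (R x)) x ⟨hx, rfl⟩
        exact ⟨n + 1, by rw [hGD x hx, hn]; simp⟩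
      · exact ⟨0, by rw [hGD' x hx]; simp⟩
  refine ⟨e, he, fun x hx => ?_, fun x => ?_, fun x hx => ?_⟩
  · rw [heG, hGD' x hx]
  · rw [heG, hGlab]
  · rw [heG, hGD x hx]
    exact hθT (lab (R x)) x ⟨hx, rfl⟩

end PointedMatching

/-! ### Kakutani–Rokhlin towers -/

section Labels

variable {X : Type*} [TopologicalSpace X]

theorem IsClopen.isLocallyConstant_mem {A : Set X} (hA : IsClopen A) :
    IsLocallyConstant fun x => x ∈ A := by
  rw [IsLocallyConstant.iff_eventually_eq]
  intro x
  by_cases hx : x ∈ A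
  · exact Filter.mem_of_superset (hA.isOpen.mem_nhds hx) fun y hy =>
      propext ⟨fun _ => hx, fun _ => hy⟩
  · exact Filter.mem_of_superset (hA.compl.isOpen.mem_nhds hx) fun y hy =>
      propext ⟨fun h => absurd h hy, fun h => absurd h hx⟩

/-- The labels of the Kakutani–Rokhlin towers under `R` with roof `U`: the level of a point together
with the itinerary of its column. They refine any given locally constant function. -/
theorem exists_tower_labels [IsCantorSpace X] [MeasurableSpace X] [BorelSpace X] {R : X ≃ₜ X}
    (hR : IsMinimalHomeo R) {U : Set X} (hU : IsClopen U) {t : X} (ht : t ∈ U) :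
    ∃ (i : X → ℕ) (v : X → X), IsLocallyConstant i ∧ Continuous v ∧
      (∀ x ∈ U, i (R x) = 0 ∧ v (R x) = R x) ∧ (∀ x ∉ U, i (R x) = i x + 1 ∧ v (R x) = v x) ∧
      (∀ x, v x = (R⁻¹ ^ i x) x) ∧ (∀ x, (R ^ i x) (v x) = x) ∧ (∀ x, i (v x) = 0 ∧ v (v x) = v x) ∧
      (∀ x, ∀ j < i x, (R ^ j) (v x) ∉ U) ∧ ∃ N, ∀ x, i x < N := by
  classical
  -- The base of the towers is the image of the roof under `R`; `i` counts the steps back to the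
  -- base and `v` is the base point reached.
  let V : Set X := R.symm ⁻¹' U
  have hV : IsClopen V := hU.preimage R.symm.continuous
  have hRV : ∀ x, R x ∈ V ↔ x ∈ U := fun x => by simp [V]
  obtain ⟨N, hN⟩ := hR.inv.exists_hitting_bound hV ⟨R t, (hRV t).2 ht⟩
  have hex : ∀ x, ∃ i, (R⁻¹ ^ i) x ∈ V := fun x => (hN x).imp fun i hi => hi.2
  let i : X → ℕ := fun x => Nat.find (hex x)
  have hi : ∀ x k, i x = k ↔ (R⁻¹ ^ k) x ∈ V ∧ ∀ j < k, (R⁻¹ ^ j) x ∉ V := fun x k =>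
    Nat.find_eq_iff (hex x)
  have hspec : ∀ x, (R⁻¹ ^ i x) x ∈ V := fun x => Nat.find_spec (hex x)
  have hmin : ∀ x, ∀ j < i x, (R⁻¹ ^ j) x ∉ V := fun x j hj => Nat.find_min (hex x) hj
  let v : X → X := fun x => (R⁻¹ ^ i x) x
  have hil : IsLocallyConstant i := IsLocallyConstant.iff_isOpen_fiber.2 fun k => by
    have : i ⁻¹' {k} = ((R⁻¹ ^ k : X ≃ₜ X) ⁻¹' V) ∩
        ⋂ j ∈ Finset.range k, ((R⁻¹ ^ j : X ≃ₜ X) ⁻¹' V)ᶜ := by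
      ext x
      simp only [Set.mem_preimage, Set.mem_singleton_iff, Set.mem_inter_iff, Set.mem_iInter,
        Finset.mem_range, Set.mem_compl_iff]
      exact hi x k
    rw [this]
    exact ((hV.preimage (Homeomorph.continuous _)).inter (isClopen_biInter_finset fun j _ =>
      (hV.preimage (Homeomorph.continuous _)).compl)).isOpen
  have hzero : ∀ x, x ∈ V → i x = 0 := fun x hx =>
    (hi x 0).2 ⟨hx, fun j hj => absurd hj (Nat.not_lt_zero j)⟩
  have hpow : ∀ j x, (R⁻¹ ^ (j + 1)) (R x) = (R⁻¹ ^ j) x := fun j x => by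
    rw [pow_succ, Homeomorph.mul_apply, Homeomorph.inv_apply, Homeomorph.symm_apply_apply]
  have hcancel : ∀ (n : ℕ) x, (R ^ n) ((R⁻¹ ^ n) x) = x := fun n x => by
    rw [inv_pow, Homeomorph.inv_apply, Homeomorph.apply_symm_apply]
  refine ⟨i, v, hil, ?_, fun x hx => ?_, fun x hx => ?_, fun x => rfl, fun x => hcancel _ x,
    fun x => ?_, fun x j hj hjU => ?_, N, fun x => ?_⟩
  · refine continuous_iff_continuousAt.2 fun x => ?_
    refine (R⁻¹ ^ i x).continuous.continuousAt.congr ((hil.eventually_eq x).mono fun y hy => ?_)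
    simp only [v, hy]
  · have := hzero (R x) ((hRV x).2 hx)
    exact ⟨this, by simp only [v, this]; rfl⟩
  · have h1 : i (R x) = i x + 1 := by
      refine (hi _ _).2 ⟨?_, fun j hj => ?_⟩
      · rw [hpow]; exact hspec x
      · rcases j with - | j
        · exact fun h => hx ((hRV x).1 h)
        · rw [hpow]; exact hmin x j (by omega)
    exact ⟨h1, by simp only [v, h1, hpow]⟩
  · have := hzero (v x) (hspec x)
    exact ⟨this, by simp only [v] at this ⊢; rw [this]; rfl⟩
  · have h1 : (R ^ (j + 1)) (v x) = (R⁻¹ ^ (i x - (j + 1))) x := by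
      have h2 : i x = (j + 1) + (i x - (j + 1)) := by omega
      have h3 : v x = (R⁻¹ ^ (j + 1)) ((R⁻¹ ^ (i x - (j + 1))) x) := by
        rw [Homeomorph.pow_apply_pow_apply, ← h2]
      rw [h3, hcancel]
    refine hmin x (i x - (j + 1)) (by omega) ?_
    rw [← h1, pow_succ', Homeomorph.mul_apply, hRV]
    exact hjU
  · obtain ⟨j, hj, hjV⟩ := hN x
    exact lt_of_le_of_lt (Nat.find_min' (hex x) hjV) hj

end Labels

/-! ### Shrinking the roof by a conjugation -/

section ImproveConjugate

variable {X : Type*} [TopologicalSpace X] [IsCantorSpace X] [MeasurableSpace X] [BorelSpace X]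
  {T : X ≃ₜ X}

/-- If `R` is given by positive powers of `T` off `U`, a small conjugation makes it so off the
smaller set `U'`, without changing it off `U`. -/
theorem IsMinimalHomeo.exists_conj_positive_off (hT : IsMinimalHomeo T) {R : X ≃ₜ X}
    (hR : IsMinimalHomeo R) (hRT : PreservesInvariant T R) {U U' : Set X} (hU : IsClopen U)
    (hU' : IsClopen U') (hUU' : U' ⊆ U) {t : X} (ht : t ∈ U')
    (hpos : ∀ x ∉ U, ∃ n : ℕ, R x = (T ^ (n + 1)) x) {κ : Type*} {q : X → κ}
    (hq : IsLocallyConstant q) :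
    ∃ f : X ≃ₜ X, PreservesInvariant T f ∧ f t = t ∧ f (R t) = R t ∧ (∀ x, q (f x) = q x) ∧
      (∀ x ∉ U, f (R (f.symm x)) = R x) ∧
      ∀ x ∉ U', ∃ n : ℕ, f (R (f.symm x)) = (T ^ (n + 1)) x := by
  classical
  -- The map `G` below follows the same labels as `R` up the towers, but by positive powers of `T`
  -- on `U \ U'`. Sending the point of level `i` over `v` to `(G ^ i) (e v)` conjugates `R` to `G`
  -- off `U'`.
  obtain ⟨i, v, hi, hv, hR0, hRs, hvR, hRv, hvv, hvU, N, hN⟩ := exists_tower_labels hR hU' ht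
  have hne : v t ≠ R t := by
    intro h
    have h1 : (R ^ (i t + 1)) (v t) = R t := by rw [pow_succ', Homeomorph.mul_apply, hRv]
    rw [← h] at h1
    exact hR.pow_apply_ne (Nat.succ_pos _) _ h1
  -- Recording `C` in the labels lets `e` move `v t` while fixing `R t`.
  obtain ⟨C, hC, hvC, htC⟩ := IsCantorSpace.exists_isClopen_mem_notMem hne
  let l₀ : X → κ × Prop × Prop := fun x => (q x, x ∈ U', x ∈ C)
  have hl₀ : IsLocallyConstant l₀ :=
    hq.prodMk (hU'.isLocallyConstant_mem.prodMk hC.isLocallyConstant_mem)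
  let name : X → Fin N → κ × Prop × Prop := fun x j => l₀ ((R ^ (j : ℕ)) (v x))
  let lab : X → ℕ × (Fin N → κ × Prop × Prop) := fun x => (i x, name x)
  have hname : IsLocallyConstant name := by
    rw [IsLocallyConstant.iff_eventually_eq]
    intro x
    have : ∀ j : Fin N, ∀ᶠ y in 𝓝 x, name y j = name x j := fun j =>
      (hl₀.comp_continuous ((R ^ (j : ℕ)).continuous.comp hv)).eventually_eq x
    exact (Filter.eventually_all.2 this).mono fun y hy => funext hy
  have hlab : IsLocallyConstant lab := hi.prodMk hname
  have hl₀eq : ∀ x, l₀ x = name x ⟨i x, hN x⟩ := fun x => by simp only [name, hRv]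
  have hdet : ∀ x y, lab x = lab y → l₀ x = l₀ y := by
    intro x y h
    have h1 : i x = i y := congrArg Prod.fst h
    have h2 : name x = name y := congrArg Prod.snd h
    rw [hl₀eq, hl₀eq, h2]
    congr 1
    exact Fin.ext h1
  have hdetU : ∀ x y, lab x = lab y → (x ∈ U' ↔ y ∈ U') := fun x y h =>
    Iff.of_eq (congrArg (fun z => z.2.1) (hdet x y h))
  have hlabR : ∀ x ∉ U', lab (R x) = (i x + 1, name x) := fun x hx => by
    simp only [lab, name, (hRs x hx).1, (hRs x hx).2]
  have hlabRR : ∀ x y, lab x = lab y → x ∉ U' → lab (R x) = lab (R y) := fun x y h hx => by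
    rw [hlabR x hx, hlabR y (fun hy => hx ((hdetU x y h).2 hy)),
      show i x = i y from congrArg Prod.fst h, show name x = name y from congrArg Prod.snd h]
  have hlabv : ∀ x, lab (v x) = (0, name x) := fun x => by
    simp only [lab, name, (hvv x).1, (hvv x).2]
  obtain ⟨G, hGT, hGR, hGlab, hGpos⟩ := hT.exists_positive_on hRT (hU.diff hU') hlab
  have hforward : ∀ x y, lab x = lab y → ∀ n, (∀ j < n, (R ^ j) x ∉ U') →
      lab ((G ^ n) y) = lab ((R ^ n) x) := by
    intro x y h n
    induction n with
    | zero => exact fun _ => h.symm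
    | succ n ih =>
      intro hn
      rw [pow_succ', pow_succ', Homeomorph.mul_apply, Homeomorph.mul_apply, hGlab]
      exact (hlabRR _ _ (ih fun j hj => hn j (by omega)).symm (hn n (by omega))).symm
  -- A point of positive level is not the image of a roof point, so labels can also be followed
  -- down; hence the point from which `G` climbs to `t` has the label of `v t`.
  have hback : ∀ (k : ℕ) z nm, lab ((G ^ k) z) = (k, nm) → lab z = (0, nm) := by
    intro k
    induction k with
    | zero => exact fun z nm h => h
    | succ k ih =>
      intro z nm h
      refine ih z nm ?_
      rw [pow_succ', Homeomorph.mul_apply, hGlab] at h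
      have hU : (G ^ k) z ∉ U' := by
        intro hmem
        have h1 : i (R ((G ^ k) z)) = k + 1 := congrArg Prod.fst h
        rw [(hR0 _ hmem).1] at h1
        omega
      rw [hlabR _ hU, Prod.mk.injEq] at h
      exact Prod.ext (by simpa [lab] using h.1) h.2
  have hW : IsClopen {x | lab x = lab (v t)} := hlab.isClopen_fiber _
  have hz : lab ((G ^ i t).symm t) = lab (v t) := by
    rw [hlabv]
    refine hback (i t) _ _ ?_
    rw [Homeomorph.apply_symm_apply]
  -- Without `e`, the conjugacy would send `t` to the end of the `G`-climb from `v t`, which need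
  -- not be `t`.
  obtain ⟨e, heT, het, heW', heW⟩ := hT.exists_preserving_moving hW
    (a := v t) (b := (G ^ i t).symm t) rfl hz
  have hlab_e : ∀ x, lab (e x) = lab x := fun x => by
    by_cases hx : lab x = lab (v t)
    · exact (heW x hx).trans hx.symm
    · rw [heW' x hx]
  let F : X → X := fun x => (G ^ i x) (e (v x))
  have hFlab : ∀ x, lab (F x) = lab x := fun x => by
    have h1 := hforward (v x) (e (v x)) (hlab_e _).symm (i x) (hvU x)
    rwa [hRv] at h1
  have hFpw : ∀ x, F x = (G ^ i x * e * R⁻¹ ^ i x) x := fun x => by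
    simp only [F, hvR, Homeomorph.mul_apply]
  have hFc : Continuous F := continuous_iff_continuousAt.2 fun x =>
    (G ^ i x * e * R⁻¹ ^ i x).continuous.continuousAt.congr
      ((hi.eventually_eq x).mono fun y hy => by rw [hFpw, hy])
  have hFi : Function.Injective F := fun x y hxy => by
    have h1 : i x = i y := congrArg Prod.fst ((hFlab x).symm.trans ((congrArg lab hxy).trans (hFlab y)))
    rw [hFpw, hFpw, h1] at hxy
    exact Homeomorph.injective _ hxy
  obtain ⟨f, hfF, hfT⟩ := exists_homeomorph_of_piecewise hT hFc hFi
    (fun n => G ^ n * e * R⁻¹ ^ n) (fun n => by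
      have h1 : PreservesInvariant T (R⁻¹ ^ n : X ≃ₜ X) := PreservesInvariant.pow hRT.symm n
      exact ((hGT.pow n).comp heT).comp h1) ∅ (fun μ _ => measure_empty) fun x _ => ⟨i x, hFpw x⟩
  have hfR : ∀ x ∉ U', f (R x) = G (f x) := fun x hx => by
    rw [hfF]
    simp only [F, (hRs x hx).1, (hRs x hx).2]
    rw [pow_succ', Homeomorph.mul_apply]
  have hconj : ∀ x ∉ U', f (R (f.symm x)) = G x := fun x hx => by
    rw [hfR, Homeomorph.apply_symm_apply]
    intro h
    refine hx ((hdetU _ _ ?_).1 h)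
    rw [← hFlab, ← hfF, Homeomorph.apply_symm_apply]
  refine ⟨f, hfT, ?_, ?_, fun x => ?_, fun x hx => ?_, fun x hx => ?_⟩
  · rw [hfF]
    simp only [F]
    rw [het, Homeomorph.apply_symm_apply]
  · rw [hfF]
    simp only [F]
    rw [(hR0 t ht).1, (hR0 t ht).2, pow_zero, Homeomorph.one_apply]
    refine heW' _ fun h => ?_
    have h1 : (R t ∈ C) = (v t ∈ C) := congrArg (fun z => z.2.2) (hdet _ _ h)
    exact htC (h1 ▸ hvC)
  · rw [hfF]
    exact congrArg (fun z => z.1) (hdet _ _ (hFlab x))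
  · rw [hconj x fun h => hx (hUU' h), hGR x fun h => hx h.1]
  · rw [hconj x hx]
    by_cases hxU : x ∈ U
    · exact hGpos x ⟨hxU, hx⟩
    · obtain ⟨n, hn⟩ := hpos x hxU
      exact ⟨n, by rw [hGR x fun h => hxU h.1, hn]⟩

end ImproveConjugate

/-! ### Constructing the speedup as a limit -/

section Speedup

variable {X Y : Type*}
    [TopologicalSpace X] [IsCantorSpace X] [MeasurableSpace X] [BorelSpace X]
    [TopologicalSpace Y] [IsCantorSpace Y] [MeasurableSpace Y] [BorelSpace Y]
    {T : X ≃ₜ X} {S : Y ≃ₜ Y}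

/-- The homeomorphism `h⁻¹ ∘ S ∘ h`. -/
def conjHomeo (S : Y ≃ₜ Y) (h : X ≃ₜ Y) : X ≃ₜ X := (h.trans S).trans h.symm

theorem conjHomeo_apply (S : Y ≃ₜ Y) (h : X ≃ₜ Y) (x : X) :
    conjHomeo S h x = h.symm (S (h x)) := rfl

/-- An identification of `X` with `Y` under which `S` becomes a positive power of `T` off `roof`. -/
structure PartialSpeedup (T : X ≃ₜ X) (S : Y ≃ₜ Y) (t : X) where
  toHomeo : X ≃ₜ Y
  roof : Set X
  isClopen_roof : IsClopen roof
  mem_roof : t ∈ roof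
  preserves : PreservesInvariant T (conjHomeo S toHomeo)
  conj_apply : conjHomeo S toHomeo t = T t
  positive : ∀ x ∉ roof, ∃ n : ℕ, conjHomeo S toHomeo x = (T ^ (n + 1)) x

/-- Precompose `F` with a homeomorphism fixing `t` and carrying `T t` to the image of `t` under the
conjugate of `S`. With the whole space as roof, positivity is vacuous. -/
theorem exists_initial_partialSpeedup (hT : IsMinimalHomeo T) (hS : IsMinimalHomeo S) {F : X ≃ₜ Y}
    (hF : Set.MapsTo (fun μ : Measure X => μ.map F) (invariantMeasures T) (invariantMeasures S))
    (t : X) : Nonempty (PartialSpeedup T S t) := by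
  have hR : PreservesInvariant T (conjHomeo S F) := fun μ hμ => by
    have h1 : MeasurePreserving F μ (μ.map F) := ⟨F.continuous.measurable, rfl⟩
    have h2 : MeasurePreserving F.symm (μ.map F) μ := MeasurePreserving.symm F.toMeasurableEquiv h1
    exact (h2.comp (measurePreserving_of_mem (hF hμ))).comp h1
  have hTt : T t ≠ t := by
    have := hT.pow_apply_ne one_pos t
    rwa [pow_one] at this
  have hRt : conjHomeo S F t ≠ t := by
    have := (hS.conj F).pow_apply_ne one_pos t
    rwa [pow_one] at this
  obtain ⟨C, hC, htC, hCs⟩ := IsCantorSpace.exists_isClopen_subset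
    (U := {T t, conjHomeo S F t}ᶜ) (x := t) (Set.toFinite _).isClosed.isOpen_compl
    (by simpa using ⟨hTt.symm, hRt.symm⟩)
  obtain ⟨g, hg, hgT, hgC, -⟩ := hT.exists_preserving_moving hC.compl (a := T t)
    (b := conjHomeo S F t) (fun h => hCs h (by simp)) (fun h => hCs h (by simp))
  have hgt : g t = t := hgC t (fun h => h htC)
  refine ⟨⟨g.trans F, Set.univ, isClopen_univ, trivial, (hg.symm.comp hR).comp hg, ?_,
    fun x hx => absurd trivial hx⟩⟩
  change g.symm (conjHomeo S F (g t)) = T t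
  rw [hgt, ← hgT, Homeomorph.symm_apply_apply]

/-- The label `q` records membership in the first `n + 1` sets of both lists, so a conjugation
respecting `q` leaves their preimages unchanged. -/
theorem PartialSpeedup.exists_improve (hT : IsMinimalHomeo T) (hS : IsMinimalHomeo S) {t : X}
    {V : ℕ → Set Y} (hV : ∀ k, IsClopen (V k)) {W B : ℕ → Set X} (hW : ∀ k, IsClopen (W k))
    (hB : ∀ k, IsClopen (B k)) (hBt : ∀ k, t ∈ B k) (n : ℕ) (s : PartialSpeedup T S t) :
    ∃ s' : PartialSpeedup T S t, s'.roof = s.roof ∩ B n ∧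
      (∀ k ≤ n, s'.toHomeo ⁻¹' V k = s.toHomeo ⁻¹' V k) ∧
      (∀ k ≤ n, s'.toHomeo.symm ⁻¹' W k = s.toHomeo.symm ⁻¹' W k) ∧
      ∀ x ∉ s.roof, conjHomeo S s'.toHomeo x = conjHomeo S s.toHomeo x := by
  let q : X → Fin (n + 1) → Prop × Prop := fun x k => (s.toHomeo x ∈ V k, x ∈ W k)
  have hq : IsLocallyConstant q := by
    rw [IsLocallyConstant.iff_eventually_eq]
    intro x
    have : ∀ k : Fin (n + 1), ∀ᶠ y in 𝓝 x, q y k = q x k := fun k =>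
      ((((hV k).preimage s.toHomeo.continuous).isLocallyConstant_mem).prodMk
        (hW k).isLocallyConstant_mem).eventually_eq x
    exact (Filter.eventually_all.2 this).mono fun y hy => funext hy
  obtain ⟨f, hf, hft, hfR, hfq, hoff, hpos⟩ := hT.exists_conj_positive_off (hS.conj s.toHomeo)
    s.preserves s.isClopen_roof (s.isClopen_roof.inter (hB n)) Set.inter_subset_left
    ⟨s.mem_roof, hBt n⟩ s.positive hq
  have hfq' : ∀ x, q (f.symm x) = q x := fun x => by
    rw [← hfq (f.symm x), Homeomorph.apply_symm_apply]
  refine ⟨⟨f.symm.trans s.toHomeo, s.roof ∩ B n, s.isClopen_roof.inter (hB n),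
    ⟨s.mem_roof, hBt n⟩, (hf.comp s.preserves).comp hf.symm, ?_, hpos⟩, rfl,
    fun k hk => ?_, fun k hk => ?_, hoff⟩
  · change f (conjHomeo S s.toHomeo (f.symm t)) = T t
    have h1 : f.symm t = t := by rw [Homeomorph.symm_apply_eq, hft]
    rw [h1]
    exact hfR.trans s.conj_apply
  · ext x
    exact Iff.of_eq (congrArg (fun z => (z ⟨k, by omega⟩).1) (hfq' x))
  · ext y
    exact Iff.of_eq (congrArg (fun z => (z ⟨k, by omega⟩).2) (hfq (s.toHomeo.symm y)))

/-- Preimages of each clopen set stabilise in both directions, so the identifications converge to a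
homeomorphism. The conjugates of `S` stabilise at each point to a positive power of `T`; the jump
may be unbounded near `t`. -/
theorem isSpeedup_of_mapsTo (hT : IsMinimalHomeo T) (hS : IsMinimalHomeo S) {F : X ≃ₜ Y}
    (hF : Set.MapsTo (fun μ : Measure X => μ.map F) (invariantMeasures T) (invariantMeasures S)) :
    IsSpeedup S T := by
  obtain ⟨t⟩ := IsCantorSpace.nonempty (X := X)
  obtain ⟨s₀⟩ := exists_initial_partialSpeedup hT hS hF t
  obtain ⟨V, hV, hVsurj⟩ := IsCantorSpace.exists_isClopen_enumeration Y
  obtain ⟨W, hW, hWsurj⟩ := IsCantorSpace.exists_isClopen_enumeration X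
  obtain ⟨B, -, hB, hBt, hBbasis⟩ := IsCantorSpace.exists_antitone_isClopen_basis t
  choose next hroof hnV hnW hnconj using
    PartialSpeedup.exists_improve (T := T) (S := S) hT hS hV hW hB hBt
  let s : ℕ → PartialSpeedup T S t := fun n => Nat.rec s₀ (fun n s => next n s) n
  have hsV : ∀ k n, k + 1 ≤ n → (s n).toHomeo ⁻¹' V k = (s (k + 1)).toHomeo ⁻¹' V k := by
    intro k n h
    induction n, h using Nat.le_induction with
    | base => rfl
    | succ n hn ih => exact (hnV n (s n) k (by omega)).trans ih
  have hsW : ∀ k n, k + 1 ≤ n → (s n).toHomeo.symm ⁻¹' W k = (s (k + 1)).toHomeo.symm ⁻¹' W k := by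
    intro k n h
    induction n, h using Nat.le_induction with
    | base => rfl
    | succ n hn ih => exact (hnW n (s n) k (by omega)).trans ih
  have hanti : Antitone fun n => (s n).roof := antitone_nat_of_succ_le fun n =>
    (hroof n (s n)).le.trans Set.inter_subset_left
  have hconj : ∀ k x, x ∉ (s k).roof → ∀ n, k ≤ n →
      conjHomeo S (s n).toHomeo x = conjHomeo S (s k).toHomeo x := by
    intro k x hx n h
    induction n, h using Nat.le_induction with
    | base => rfl
    | succ n hn ih => exact (hnconj n (s n) x fun h => hx (hanti hn h)).trans ih
  obtain ⟨h, hh⟩ : ∃ h : X ≃ₜ Y, ∀ A B, IsClopen A →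
      (IsClopen B ∧ ∃ N, ∀ n ≥ N, (s n).toHomeo ⁻¹' A = B) → h ⁻¹' A = B := by
    refine exists_homeomorph_of_clopen_rel _ (fun A B hAB => hAB.1) (fun A hA => ?_)
      (fun B hB => ?_) ?_
    · obtain ⟨k, rfl⟩ := hVsurj A hA
      exact ⟨_, hA.preimage (s (k + 1)).toHomeo.continuous, k + 1, hsV k⟩
    · obtain ⟨k, rfl⟩ := hWsurj B hB
      refine ⟨_, hB.preimage (s (k + 1)).toHomeo.symm.continuous, hB, k + 1, fun n hn => ?_⟩
      rw [← hsW k n hn, ← Set.preimage_comp, Homeomorph.symm_comp_self, Set.preimage_id]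
    · rintro A A' B B' ⟨-, m, hm⟩ ⟨-, n, hn⟩
      rw [← hm _ (le_max_left m n), ← hn _ (le_max_right m n)]
      exact (Set.preimage_subset_preimage_iff (by
        rw [(s (max m n)).toHomeo.range_coe]; exact Set.subset_univ _)).symm
  have hlim : ∀ A, IsClopen A → ∃ N, ∀ n ≥ N, (s n).toHomeo ⁻¹' A = h ⁻¹' A := by
    intro A hA
    obtain ⟨k, rfl⟩ := hVsurj A hA
    refine ⟨k + 1, fun n hn => ?_⟩
    rw [hsV k n hn]
    exact (hh _ _ hA ⟨hA.preimage (s (k + 1)).toHomeo.continuous, k + 1, hsV k⟩).symm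
  have hstable : ∀ x, ∃ n : ℕ, ∃ N, ∀ m ≥ N, conjHomeo S (s m).toHomeo x = (T ^ (n + 1)) x := by
    intro x
    -- The point `t` lies in every roof, but its image is always `T t`. Any other point leaves the
    -- roofs, and its image is frozen from then on.
    by_cases hx : x = t
    · subst hx
      exact ⟨0, 0, fun m _ => by rw [(s m).conj_apply, zero_add, pow_one]⟩
    · obtain ⟨k, hk⟩ := hBbasis {x}ᶜ isOpen_compl_singleton (by simpa using Ne.symm hx)
      have hxk : x ∉ (s (k + 1)).roof := fun hmem => by
        have h1 : (s (k + 1)).roof = (s k).roof ∩ B k := hroof k (s k)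
        rw [h1] at hmem
        exact hk hmem.2 rfl
      obtain ⟨n, hn⟩ := (s (k + 1)).positive x hxk
      exact ⟨n, k + 1, fun m hm => (hconj _ x hxk m hm).trans hn⟩
  choose p hp using hstable
  refine ⟨fun x => p x + 1, fun x => Nat.succ_pos _, h, fun x => ?_⟩
  rw [← Homeomorph.pow_apply_eq_iterate]
  obtain ⟨N, hN⟩ := hp x
  refine IsCantorSpace.eq_of_forall_clopens fun A => ?_
  obtain ⟨N₁, hN₁⟩ := hlim A A.isClopen
  obtain ⟨N₂, hN₂⟩ := hlim (S ⁻¹' A) (A.isClopen.preimage S.continuous)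
  obtain ⟨n, hn, hn₁, hn₂⟩ : ∃ n, N ≤ n ∧ N₁ ≤ n ∧ N₂ ≤ n :=
    ⟨max N (max N₁ N₂), by simp, by simp, by simp⟩
  have h1 : (s n).toHomeo ((T ^ (p x + 1)) x) = S ((s n).toHomeo x) := by
    rw [← hN n hn, conjHomeo_apply, Homeomorph.apply_symm_apply]
  have h2 : h ((T ^ (p x + 1)) x) ∈ A ↔ (s n).toHomeo ((T ^ (p x + 1)) x) ∈ A :=
    Iff.of_eq (congrArg (fun Z => (T ^ (p x + 1)) x ∈ Z) (hN₁ n hn₁)).symm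
  have h3 : S (h x) ∈ A ↔ S ((s n).toHomeo x) ∈ A :=
    Iff.of_eq (congrArg (fun Z => x ∈ Z) (hN₂ n hn₂)).symm
  rw [h2, h3, h1]

end Speedup

/-! ### The equivalence -/

theorem theorem1 {X Y : Type*}
    [TopologicalSpace X] [IsCantorSpace X] [MeasurableSpace X] [BorelSpace X]
    [TopologicalSpace Y] [IsCantorSpace Y] [MeasurableSpace Y] [BorelSpace Y]
    (T : X ≃ₜ X) (S : Y ≃ₜ Y) (hT : IsMinimalHomeo T) (hS : IsMinimalHomeo S) :
    List.TFAE
      [IsSpeedup S T,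
       ∃ φ : DimGroupModInf S →+ DimGroupModInf T,
         IsExhaustiveUnitalEpi (posCone S) (orderUnit S) (posCone T) (orderUnit T) φ,
       ∃ F : X ≃ₜ Y,
         Set.MapsTo (fun μ : Measure X => μ.map F) (invariantMeasures T) (invariantMeasures S) ∧
         Set.InjOn (fun μ : Measure X => μ.map F) (invariantMeasures T)] := by
  tfae_have 1 → 3 := fun h => by
    obtain ⟨F, hF⟩ := h.exists_mapsTo
    exact ⟨F, hF, injOn_map_homeomorph F _⟩
  tfae_have 3 → 2 := fun ⟨F, hF, _⟩ => exists_exhaustive_of_mapsTo hT hS F hF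
  tfae_have 2 → 3 := fun ⟨φ, hφ⟩ => by
    obtain ⟨F, hF⟩ := exists_mapsTo_of_exhaustive hT hS hφ
    exact ⟨F, hF, injOn_map_homeomorph F _⟩
  tfae_have 3 → 1 := fun ⟨F, hF, _⟩ => isSpeedup_of_mapsTo hT hS hF
  tfae_finish
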